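/- There are two firms, $1$ and $2$, a measure $\beta>0$ of $A$-workers and a measure $1$ of $B$-workers. The productivity $v\in[0,1]$ of the workers of group $g\in\{A,B\}$ has a (measurable) density $f_g$ on $[0,1]$ with $0<\inf_{[0,1]} f_g\le\sup_{[0,1]} f_g<\infty$. An \emph{outcome for firm $i$} consists of measurable functions $f^i_g:[0,1]\to[0,\infty)$ with $f^i_g\le f_g$ (workers hired) and $w_i^g:[0,1]\to[0,\infty)$ (wages) for $g\in\{A,B\}$, with finite wage bills $\int_0^1 w_i^g f_g^i\,dv$, such that $w_i^g(v)=0$ whenever $f^i_g(v)=0$; $w_i^g(v)\ge w_i^g(v')$ whenever $v\ge v'$ and $f_g^i(v)>0$; and (group-based equal pay) for no group $g$, with $-g$ denoting the other group, are there sets $V_g,V_{-g}\subseteq[0,1]$ of positive measure with $f^i_g>0$ on $V_g$, $f^i_{-g}>0$ on $V_{-g}$ and $\inf_{V_{-g}}w_i^{-g}>\sup_{V_g}w_i^g$. Its profit is $\pi_i=\beta\int_0^1(v-w_i^A)f_A^i\,dv+\int_0^1(v-w_i^B)f_B^i\,dv$. An \emph{outcome} is a pair of outcomes for firms $1$ and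 $2$ with $f_g^1+f_g^2\le f_g$ on $[0,1]$ for each $g$. It is \emph{blocked} by firm $j$ (the other firm being $-j$) via an outcome $(\tilde f^j_g,\tilde w_j^g)_{g}$ for firm $j$ if the profit of the latter exceeds that of firm $j$ in the original outcome and, for each $g$ and almost every $v\in[0,1]$, one of the following holds at $v$: (1) $\tilde w_j^g\ge w_j^g$ and $\tilde w_j^g>w_{-j}^g$; (2) $\tilde w_j^g\ge w_j^g$ and $\tilde f^j_g+f^{-j}_g\le f_g$; (3) $\tilde w_j^g>w_{-j}^g$ and $\tilde f^j_g+f^j_g\le f_g$; (4) $\tilde f^j_g+f^j_g+f^{-j}_g\le f_g$. A \emph{core outcome} is an outcome that is not blocked. A \emph{core outcome with $B$-wages $w_2$} is a core outcome in which firm $1$ hires all $A$-workers ($f_A^1=f_A$ on $[0,1]$), firm $2$ hires all $B$-workers ($f_B^2=f_B$ on $[0,1]$), and $w_2^B=w_2$ on $[0,1]$. Fix $f_A$ and $f_B$. (a) Suppose that $f_A$ is continuous on $[0,1]$. Let $w_2:[0,1]\to[0,\infty)$ be non-decreasing and continuous with $w_2(v)\le v$ for all $v\in[0,1)$, and put $w_2^{-1}(\epsilon)=\sup\{v\in[0,1]: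 w_2(v)\le\epsilon\}$ for $\epsilon\in[0,1]$. Suppose that $w_2^{-1}$ is absolutely continuous on $[0,1]$ and that $\epsilon\mapsto\int_\epsilon^{w_2^{-1}(\epsilon)}(v-\epsilon)f_B(v)\,dv$ is non-increasing on $[0,1]$. Then there is $\beta^*\in[0,\infty)$ such that a core outcome with $B$-wages $w_2$ exists for every $\beta>\beta^*$ and for no $\beta\in(0,\beta^*)$. (b) For $w_2\equiv 0$, without assuming that $f_A$ is continuous, there is $\beta^*\in(0,\infty)$ such that a core outcome with $B$-wages $w_2\equiv0$ exists for every $\beta>\beta^*$ and for no $\beta\in(0,\beta^*)$. -/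

import Mathlib

open MeasureTheory Set

noncomputable section

namespace EPSW

/-- The two groups of workers. -/
inductive WorkerGroup where
  | A
  | B

/-- The other group. -/
def WorkerGroup.other : WorkerGroup → WorkerGroup
  | .A => .B
  | .B => .A

/-- The two firms. -/
inductive Firm where
  | one
  | two

/-- The other firm. -/
def Firm.other : Firm → Firm
  | .one => .two
  | .two => .one

/-- `f` is (on `[0,1]`) the density of an absolutely continuous distribution on `[0,1]` whose
infimum on `[0,1]` is positive and whose supremum on `[0,1]` is finite. The values of `f` outside
`[0,1]` play no role anywhere. -/
structure IsProductivityDensity (f : ℝ → ℝ) : Prop where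
  measurable : Measurable f
  bounded_below : ∃ l : ℝ, 0 < l ∧ ∀ v ∈ Icc (0 : ℝ) 1, l ≤ f v
  bounded_above : ∃ u : ℝ, ∀ v ∈ Icc (0 : ℝ) 1, f v ≤ u
  integral_eq_one : ∫ v in (0 : ℝ)..1, f v = 1

/-- An outcome for one firm under group-based equal pay for similar work, in a market where the
workers of group `g` have productivity density `f g`. Only productivities in `[0,1]` matter. -/
structure FirmOutcome (f : WorkerGroup → ℝ → ℝ) where
  /-- density of the workers of each type hired by the firm -/
  hire : WorkerGroup → ℝ → ℝ
  /-- wage paid by the firm to the workers of each type it hires -/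
  wage : WorkerGroup → ℝ → ℝ
  measurable_hire : ∀ g, Measurable (hire g)
  measurable_wage : ∀ g, Measurable (wage g)
  hire_mem : ∀ g, ∀ v ∈ Icc (0 : ℝ) 1, hire g v ∈ Icc 0 (f g v)
  wage_nonneg : ∀ g, ∀ v ∈ Icc (0 : ℝ) 1, 0 ≤ wage g v
  wage_eq_zero : ∀ g, ∀ v ∈ Icc (0 : ℝ) 1, hire g v = 0 → wage g v = 0
  /-- wages are non-decreasing in productivity within the firm and the group -/
  wage_mono : ∀ g, ∀ v ∈ Icc (0 : ℝ) 1, ∀ v' ∈ Icc (0 : ℝ) 1,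
    v' ≤ v → 0 < hire g v → wage g v' ≤ wage g v
  /-- The wage bill is finite, so that the profit is a real number. This excludes only outcomes
  with profit `-∞`: these never block, and are always blocked by hiring nobody. -/
  integrable_wage_bill : ∀ g, IntegrableOn (fun v => wage g v * hire g v) (Icc 0 1)
  /-- Group-based equal pay: there are no two sets `V`, `V'` of positive measure such that the firm
  hires from group `g` on `V`, from the other group on `V'`, and the infimum of the wages on `V'`
  exceeds the supremum of the wages on `V`. -/
  equal_pay : ∀ g, ¬ ∃ V V' : Set ℝ,
    (V ⊆ Icc 0 1 ∧ MeasurableSet V ∧ 0 < volume V) ∧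
    (V' ⊆ Icc 0 1 ∧ MeasurableSet V' ∧ 0 < volume V') ∧
    (∀ v ∈ V, 0 < hire g v) ∧ (∀ v ∈ V', 0 < hire g.other v) ∧
    ∃ c d : ℝ, c < d ∧ (∀ v ∈ V, wage g v ≤ c) ∧ (∀ v ∈ V', d ≤ wage g.other v)

/-- The profit of a firm, when group `A` has measure `β` and group `B` has measure `1`. -/
def FirmOutcome.profit {f : WorkerGroup → ℝ → ℝ} (β : ℝ) (P : FirmOutcome f) : ℝ :=
  β * (∫ v in (0 : ℝ)..1, (v - P.wage .A v) * P.hire .A v) +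
    ∫ v in (0 : ℝ)..1, (v - P.wage .B v) * P.hire .B v

/-- An outcome: one outcome for each firm, with total hiring at most the supply of workers. -/
structure Outcome (f : WorkerGroup → ℝ → ℝ) where
  firm : Firm → FirmOutcome f
  feasible : ∀ g, ∀ v ∈ Icc (0 : ℝ) 1,
    (firm .one).hire g v + (firm .two).hire g v ≤ f g v

/-- The outcome `O` is blocked by firm `j` via the alternative outcome `P` for `j`. -/
def Outcome.BlockedBy {f : WorkerGroup → ℝ → ℝ} (β : ℝ) (O : Outcome f) (j : Firm)
    (P : FirmOutcome f) : Prop :=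
  (O.firm j).profit β < P.profit β ∧
  ∀ g : WorkerGroup, ∀ᵐ v ∂(volume.restrict (Icc (0 : ℝ) 1)),
    ((O.firm j).wage g v ≤ P.wage g v ∧ (O.firm j.other).wage g v < P.wage g v) ∨
    ((O.firm j).wage g v ≤ P.wage g v ∧
      P.hire g v + (O.firm j.other).hire g v ≤ f g v) ∨
    ((O.firm j.other).wage g v < P.wage g v ∧
      P.hire g v + (O.firm j).hire g v ≤ f g v) ∨
    P.hire g v + (O.firm j).hire g v + (O.firm j.other).hire g v ≤ f g v

/-- A core outcome: one that no firm can block. -/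
def Outcome.IsCore {f : WorkerGroup → ℝ → ℝ} (β : ℝ) (O : Outcome f) : Prop :=
  ¬ ∃ (j : Firm) (P : FirmOutcome f), O.BlockedBy β j P

/-- There is a core outcome in which firm 1 hires all `A`-workers, firm 2 hires all `B`-workers,
and the wage schedule of the `B`-workers is `w₂`. -/
def ExistsCoreWithBWages (β : ℝ) (f : WorkerGroup → ℝ → ℝ) (w₂ : ℝ → ℝ) : Prop :=
  ∃ O : Outcome f, O.IsCore β ∧
    (∀ v ∈ Icc (0 : ℝ) 1, (O.firm .one).hire .A v = f .A v) ∧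
    (∀ v ∈ Icc (0 : ℝ) 1, (O.firm .two).hire .B v = f .B v) ∧
    (∀ v ∈ Icc (0 : ℝ) 1, (O.firm .two).wage .B v = w₂ v)

/-- A wage function: non-negative and non-decreasing on `[0,1]`. -/
structure IsWageFunction (w : ℝ → ℝ) : Prop where
  nonneg : ∀ v ∈ Icc (0 : ℝ) 1, 0 ≤ w v
  mono : MonotoneOn w (Icc 0 1)

/-- The generalized inverse of a wage function: the supremum of the `v ∈ [0,1]` with `w v ≤ ε`,
and `0` if there is no such `v` (in Lean, `sSup ∅ = 0`). -/
def wageInv (w : ℝ → ℝ) (ε : ℝ) : ℝ :=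
  sSup {v : ℝ | v ∈ Icc (0 : ℝ) 1 ∧ w v ≤ ε}

/-- `βs` is a threshold for `w₂`: above it `w₂` is supported by a core outcome, and below it
(among positive measures `β` of group `A`) it is not. -/
def IsThreshold (f : WorkerGroup → ℝ → ℝ) (w₂ : ℝ → ℝ) (βs : ℝ) : Prop :=
  (∀ β : ℝ, 0 < β → βs < β → ExistsCoreWithBWages β f w₂) ∧
  (∀ β : ℝ, 0 < β → β < βs → ¬ ExistsCoreWithBWages β f w₂)

end EPSW

end

namespace EPSW

/-! The existence of a segregated core outcome reduces to conditions on two wage functions. Equal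
pay forces a firm that hires from both groups to pay almost all of them one wage `c`. A deviation
therefore either targets a single group, and gains at most that group's current profit, or pays a
common wage `c`, and gains at most about `β * surplus A c + surplus B c`. Conversely, each firm can
take over the other's workforce at slightly higher wages, or poach from both groups at a common
wage. Hence `w` supports the outcome exactly when wages are at most productivity below `1`, the two
profits are equal, and no common wage yields more than that profit (`Supports`,
`Supports.existsCore`, `Outcome.IsCore.exists_supports`).

These conditions are upward closed in `β`. When `β` grows to `β'`, put `lam = β / β'` and replace
the `A`-wages by wages for which, at each `c`, the mass of workers with wage below `c` and
productivity at least `c` is multiplied by `lam` and sits at the lowest productivities above `c`.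
Integrating over `c`, the profit per unit of group size is multiplied by exactly `lam`; each surplus
becomes at most `lam` times the old one, because the retained mass is the least productive
(`exists_wage_surplus_le`).

Some `β` works as soon as the `B`-surplus never exceeds the `B`-profit: `A`-wages leaving a tiny
profit, all of it near productivity `1`, are compensated by a large `β` (`exists_supports`). The
threshold is the infimum of the supported `β`. In (a) the monotonicity hypothesis, compared at `0`
and `c`, bounds the `B`-surplus; in (b) equality of profits bounds `β` away from `0`. -/

/-- The distribution on `[0,1]` with density `f`. -/
noncomputable def law (f : ℝ → ℝ) : Measure ℝ :=
  (volume.restrict (Icc 0 1)).withDensity fun v => ENNReal.ofReal (f v)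

/-- The largest profit per unit of group size from workers with distribution `law f` and wages
below `c`, when each of them is paid `c`. -/
noncomputable def surplus (f w : ℝ → ℝ) (c : ℝ) : ℝ :=
  ∫ v, {v | w v < c}.indicator (fun v => max (v - c) 0) v ∂law f

/-! ### Productivity distributions -/

section law

variable {f : ℝ → ℝ}

theorem IsProductivityDensity.pos (hf : IsProductivityDensity f) {v : ℝ}
    (hv : v ∈ Icc (0 : ℝ) 1) : 0 < f v := by
  obtain ⟨l, hl, h⟩ := hf.bounded_below
  exact hl.trans_le (h v hv)

theorem ae_law_mem (f : ℝ → ℝ) : ∀ᵐ v ∂law f, v ∈ Icc (0 : ℝ) 1 :=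
  (withDensity_absolutelyContinuous _ _).ae_le (ae_restrict_mem measurableSet_Icc)

theorem IsProductivityDensity.ae_toReal (hf : IsProductivityDensity f) :
    ∀ᵐ v ∂volume.restrict (Icc (0 : ℝ) 1), (ENNReal.ofReal (f v)).toReal = f v := by
  filter_upwards [ae_restrict_mem measurableSet_Icc] with v hv
  exact ENNReal.toReal_ofReal (hf.pos hv).le

theorem IsProductivityDensity.integral_law (hf : IsProductivityDensity f) (g : ℝ → ℝ) :
    ∫ v, g v ∂law f = ∫ v in Icc (0 : ℝ) 1, g v * f v := by
  rw [law, integral_withDensity_eq_integral_toReal_smul hf.measurable.ennreal_ofReal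
    (Filter.Eventually.of_forall fun _ => ENNReal.ofReal_lt_top)]
  refine integral_congr_ae ?_
  filter_upwards [hf.ae_toReal] with v hv
  rw [hv, smul_eq_mul, mul_comm]

theorem IsProductivityDensity.integrable_law_iff (hf : IsProductivityDensity f) {g : ℝ → ℝ} :
    Integrable g (law f) ↔ IntegrableOn (fun v => g v * f v) (Icc 0 1) := by
  rw [law, integrable_withDensity_iff_integrable_smul' hf.measurable.ennreal_ofReal
    (Filter.Eventually.of_forall fun _ => ENNReal.ofReal_lt_top)]
  refine integrable_congr ?_
  filter_upwards [hf.ae_toReal] with v hv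
  rw [hv, smul_eq_mul, mul_comm]

theorem IsProductivityDensity.isProbabilityMeasure (hf : IsProductivityDensity f) :
    IsProbabilityMeasure (law f) := by
  have h1 : ∫ v in Icc (0 : ℝ) 1, f v = 1 := by
    rw [integral_Icc_eq_integral_Ioc, ← intervalIntegral.integral_of_le zero_le_one,
      hf.integral_eq_one]
  have hi : IntegrableOn f (Icc 0 1) := by
    by_contra h
    rw [integral_undef h] at h1
    exact zero_ne_one h1
  constructor
  rw [law, withDensity_apply _ MeasurableSet.univ, Measure.restrict_univ,
    ← ofReal_integral_eq_lintegral_ofReal hi, h1, ENNReal.ofReal_one]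
  filter_upwards [ae_restrict_mem measurableSet_Icc] with v hv using (hf.pos hv).le

theorem integrable_law_of_bound (hf : IsProductivityDensity f) {g : ℝ → ℝ} (hg : Measurable g)
    (C : ℝ) (hC : ∀ v ∈ Icc (0 : ℝ) 1, |g v| ≤ C) : Integrable g (law f) := by
  have := hf.isProbabilityMeasure
  refine Integrable.of_bound hg.aestronglyMeasurable C ?_
  filter_upwards [ae_law_mem f] with v hv using hC v hv

instance : NullSingletonClass (law f) := by
  unfold law; infer_instance

theorem IsProductivityDensity.volume_absolutelyContinuous_law (hf : IsProductivityDensity f) :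
    volume.restrict (Icc (0 : ℝ) 1) ≪ law f := by
  refine withDensity_absolutelyContinuous' hf.measurable.ennreal_ofReal.aemeasurable ?_
  filter_upwards [ae_restrict_mem measurableSet_Icc] with v hv
  simpa using hf.pos hv

theorem IsProductivityDensity.law_Ioc_pos (hf : IsProductivityDensity f) {a b : ℝ} (ha : 0 ≤ a)
    (hab : a < b) (hb : b ≤ 1) : 0 < law f (Ioc a b) := by
  refine pos_iff_ne_zero.2 fun h => ?_
  have := hf.volume_absolutelyContinuous_law h
  rw [Measure.restrict_apply measurableSet_Ioc, inter_eq_left.2, Real.volume_Ioc] at this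
  · simp at this; linarith
  · exact fun x hx => ⟨ha.trans hx.1.le, hx.2.trans hb⟩

theorem IsProductivityDensity.exists_law_Ioc_le (hf : IsProductivityDensity f) :
    ∃ u : ℝ, 0 < u ∧ ∀ a b : ℝ, a ≤ b → (law f).real (Ioc a b) ≤ u * (b - a) := by
  obtain ⟨u, hu⟩ := hf.bounded_above
  have hu0 : 0 < u := (hf.pos ⟨le_rfl, zero_le_one⟩).trans_le (hu 0 ⟨le_rfl, zero_le_one⟩)
  refine ⟨u, hu0, fun a b hab => ?_⟩
  refine ENNReal.toReal_le_of_le_ofReal (mul_nonneg hu0.le (by linarith)) ?_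
  rw [law, withDensity_apply _ measurableSet_Ioc, ENNReal.ofReal_mul hu0.le, ← Real.volume_Ioc]
  rw [Measure.restrict_restrict measurableSet_Ioc]
  calc _ ≤ ∫⁻ _ in Ioc a b ∩ Icc 0 1, ENNReal.ofReal u := by
        refine setLIntegral_mono measurable_const fun v hv => ENNReal.ofReal_le_ofReal (hu v hv.2)
    _ ≤ _ := by
        rw [setLIntegral_const]
        gcongr
        exact inter_subset_left

theorem IsProductivityDensity.exists_le_law_Ioc (hf : IsProductivityDensity f) :
    ∃ l : ℝ, 0 < l ∧ ∀ a b : ℝ, 0 ≤ a → a ≤ b → b ≤ 1 →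
      l * (b - a) ≤ (law f).real (Ioc a b) := by
  have := hf.isProbabilityMeasure
  obtain ⟨l, hl0, hl⟩ := hf.bounded_below
  refine ⟨l, hl0, fun a b ha hab hb => ?_⟩
  refine (ENNReal.ofReal_le_iff_le_toReal (measure_ne_top _ _)).1 ?_
  rw [law, withDensity_apply _ measurableSet_Ioc, ENNReal.ofReal_mul hl0.le, ← Real.volume_Ioc]
  rw [Measure.restrict_restrict measurableSet_Ioc, inter_eq_left.2, ← setLIntegral_const]
  · exact setLIntegral_mono hf.measurable.ennreal_ofReal fun v hv =>
      ENNReal.ofReal_le_ofReal (hl v ⟨ha.trans hv.1.le, hv.2.trans hb⟩)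
  · exact fun x hx => ⟨ha.trans hx.1.le, hx.2.trans hb⟩

end law

/-! ### The surplus from poaching at a common wage -/

section surplus

variable {f w : ℝ → ℝ}

theorem integrable_surplus (hf : IsProductivityDensity f) (hw : Monotone w) (c : ℝ) :
    Integrable ({v | w v < c}.indicator fun v => max (v - c) 0) (law f) := by
  refine integrable_law_of_bound hf (Measurable.indicator (by fun_prop)
    (measurableSet_lt hw.measurable measurable_const)) (1 + |c|) fun v hv => ?_
  have h1 := neg_abs_le c
  have h2 := abs_nonneg c
  by_cases h : w v < c
  · rw [indicator_of_mem (s := {v | w v < c}) h, abs_of_nonneg (le_max_right _ _)]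
    exact max_le (by linarith [hv.2]) (by linarith)
  · rw [indicator_of_notMem (s := {v | w v < c}) h, abs_zero]
    linarith

theorem integrable_sub_wage (hf : IsProductivityDensity f) (hw : Monotone w) :
    Integrable (fun v => v - w v) (law f) := by
  refine integrable_law_of_bound hf (measurable_id.sub hw.measurable) (1 + (|w 0| + |w 1|))
    fun v hv => ?_
  have h1 := hw hv.1
  have h2 := hw hv.2
  have := neg_abs_le (w 0)
  have := abs_nonneg (w 0)
  have := le_abs_self (w 1)
  have := abs_nonneg (w 1)
  exact abs_le.2 ⟨by linarith [hv.1], by linarith [hv.2]⟩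

theorem surplus_of_nonpos (hw : ∀ v, 0 ≤ w v) {c : ℝ} (hc : c ≤ 0) : surplus f w c = 0 := by
  have : {v | w v < c} = ∅ := eq_empty_of_forall_notMem fun v hv => by
    have := hw v
    have hv : w v < c := hv
    linarith
  simp [surplus, this]

theorem surplus_of_one_le {c : ℝ} (hc : 1 ≤ c) : surplus f w c = 0 := by
  refine integral_eq_zero_of_ae ?_
  filter_upwards [ae_law_mem f] with v hv
  by_cases h : w v < c
  · rw [indicator_of_mem (s := {v | w v < c}) h, max_eq_right (by linarith [hv.2])]; rfl
  · rw [indicator_of_notMem (s := {v | w v < c}) h]; rfl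

/-- Workers with wages at most `c` can be hired almost as profitably at a slightly higher wage. -/
theorem integral_wage_le_le_surplus_add (hf : IsProductivityDensity f) (hw : Monotone w) (c : ℝ)
    {ε : ℝ} (hε : 0 < ε) :
    ∫ v, {v | w v ≤ c}.indicator (fun v => max (v - c) 0) v ∂law f ≤ surplus f w (c + ε) + ε := by
  have := hf.isProbabilityMeasure
  have h : ∫ v, ({v | w v < c + ε}.indicator (fun v => max (v - (c + ε)) 0) v + ε) ∂law f
      = surplus f w (c + ε) + ε := by
    rw [integral_add (integrable_surplus hf hw _) (integrable_const _)]
    simp [surplus]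
  rw [← h]
  refine integral_mono_of_nonneg (Filter.Eventually.of_forall fun _ =>
    indicator_nonneg (fun _ _ => le_max_right _ _) _)
    ((integrable_surplus hf hw _).add (integrable_const _)) (Filter.Eventually.of_forall fun v => ?_)
  by_cases h : w v ≤ c
  · have h' : w v < c + ε := by linarith
    simp only [indicator_of_mem (s := {v | w v ≤ c}) h,
      indicator_of_mem (s := {v | w v < c + ε}) h']
    exact max_le (by linarith [le_max_left (v - (c + ε)) 0])
      (by linarith [le_max_right (v - (c + ε)) 0])
  · simp only [indicator_of_notMem (s := {v | w v ≤ c}) h]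
    have := indicator_nonneg (s := {v | w v < c + ε}) (f := fun v => max (v - (c + ε)) 0)
      (fun _ _ => le_max_right _ _) v
    linarith

end surplus

/-! ### Firm outcomes and the consequences of equal pay -/

variable {f : WorkerGroup → ℝ → ℝ}

theorem FirmOutcome.profit_eq (P : FirmOutcome f) (β : ℝ) :
    P.profit β = β * (∫ v in Icc (0 : ℝ) 1, (v - P.wage .A v) * P.hire .A v) +
      ∫ v in Icc (0 : ℝ) 1, (v - P.wage .B v) * P.hire .B v := by
  simp only [FirmOutcome.profit, intervalIntegral.integral_of_le zero_le_one,
    integral_Icc_eq_integral_Ioc]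

/-- The outcome for a firm that hires all workers of group `g` with productivity in `S g`, and pays
them according to the wage function `w g`. -/
noncomputable def FirmOutcome.ofWages (hf : ∀ g, IsProductivityDensity (f g))
    (S : WorkerGroup → Set ℝ) (hS : ∀ g, MeasurableSet (S g)) (w : WorkerGroup → ℝ → ℝ)
    (hw : ∀ g, Monotone (w g)) (hw0 : ∀ g v, 0 ≤ w g v)
    (heq : (∃ g, S g = ∅) ∨ ∃ c, ∀ g v, w g v = c) : FirmOutcome f where
  hire g := (S g).indicator (f g)
  wage g := (S g).indicator (w g)
  measurable_hire g := (hf g).measurable.indicator (hS g)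
  measurable_wage g := (hw g).measurable.indicator (hS g)
  hire_mem g v hv := ⟨indicator_apply_nonneg fun _ => ((hf g).pos hv).le,
    indicator_apply_le' (fun _ => le_rfl) fun _ => ((hf g).pos hv).le⟩
  wage_nonneg g v _ := indicator_nonneg (fun _ _ => hw0 g _) v
  wage_eq_zero g v hv h := by
    refine indicator_of_notMem (fun hS => ?_) _
    rw [indicator_of_mem hS] at h
    exact ((hf g).pos hv).ne' h
  wage_mono g v hv v' hv' hle h := by
    have hmem : v ∈ S g := mem_of_indicator_ne_zero h.ne'
    rw [indicator_of_mem hmem]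
    exact (indicator_le_self' (fun _ _ => hw0 g _) v').trans (hw g hle)
  integrable_wage_bill g := by
    have h : Integrable ((S g).indicator (w g)) (law (f g)) := by
      refine integrable_law_of_bound (hf g) ((hw g).measurable.indicator (hS g)) (w g 1) fun v hv => ?_
      rw [abs_of_nonneg (indicator_nonneg (fun _ _ => hw0 g _) v)]
      exact (indicator_le_self' (fun _ _ => hw0 g _) v).trans (hw g hv.2)
    refine ((hf g).integrable_law_iff.1 h).congr (Filter.Eventually.of_forall fun v => ?_)
    by_cases hv : v ∈ S g <;> simp [hv]
  equal_pay g := by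
    rintro ⟨V, V', ⟨-, -, hV⟩, ⟨-, -, hV'⟩, hh, hh', c, d, hcd, hc, hd⟩
    obtain ⟨v, hv⟩ := nonempty_of_measure_ne_zero hV.ne'
    obtain ⟨v', hv'⟩ := nonempty_of_measure_ne_zero hV'.ne'
    have m : v ∈ S g := mem_of_indicator_ne_zero (hh v hv).ne'
    have m' : v' ∈ S g.other := mem_of_indicator_ne_zero (hh' v' hv').ne'
    rcases heq with ⟨g', hg'⟩ | ⟨e, he⟩
    · cases g <;> cases g' <;> simp_all [WorkerGroup.other]
    · have h1 := hc v hv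
      have h2 := hd v' hv'
      rw [indicator_of_mem m, he] at h1
      rw [indicator_of_mem m', he] at h2
      linarith

theorem FirmOutcome.profit_ofWages (hf : ∀ g, IsProductivityDensity (f g))
    {S : WorkerGroup → Set ℝ} (hS : ∀ g, MeasurableSet (S g)) {w : WorkerGroup → ℝ → ℝ}
    (hw : ∀ g, Monotone (w g)) (hw0 : ∀ g v, 0 ≤ w g v)
    (heq : (∃ g, S g = ∅) ∨ ∃ c, ∀ g v, w g v = c) (β : ℝ) :
    (ofWages hf S hS w hw hw0 heq).profit β =
      β * (∫ v, (S .A).indicator (fun v => v - w .A v) v ∂law (f .A)) +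
        ∫ v, (S .B).indicator (fun v => v - w .B v) v ∂law (f .B) := by
  have h (g : WorkerGroup) : (fun v => (S g).indicator (fun v => v - w g v) v * f g v) =
      fun v => (v - (S g).indicator (w g) v) * (S g).indicator (f g) v := by
    funext v
    by_cases hv : v ∈ S g <;> simp [hv]
  rw [profit_eq, (hf .A).integral_law, (hf .B).integral_law, h, h]
  rfl

theorem FirmOutcome.integrableOn_profit (hf : ∀ g, IsProductivityDensity (f g))
    (P : FirmOutcome f) (g : WorkerGroup) :
    IntegrableOn (fun v => (v - P.wage g v) * P.hire g v) (Icc 0 1) := by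
  obtain ⟨u, hu⟩ := (hf g).bounded_above
  have h : IntegrableOn (fun v => v * P.hire g v) (Icc 0 1) := by
    refine Integrable.of_bound (measurable_id.mul (P.measurable_hire g)).aestronglyMeasurable u ?_
    filter_upwards [ae_restrict_mem measurableSet_Icc] with v hv
    have h1 := P.hire_mem g v hv
    rw [Real.norm_of_nonneg (mul_nonneg hv.1 h1.1)]
    exact (mul_le_of_le_one_left h1.1 hv.2).trans (h1.2.trans (hu v hv))
  refine (h.sub (P.integrable_wage_bill g)).congr (Filter.Eventually.of_forall fun v => ?_)
  simp [sub_mul]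

theorem FirmOutcome.integral_profit_le (hf : ∀ g, IsProductivityDensity (f g))
    (P : FirmOutcome f) (g : WorkerGroup) {h : ℝ → ℝ} (hh : Integrable h (law (f g)))
    (hle : ∀ᵐ v ∂volume.restrict (Icc (0 : ℝ) 1),
      (v - P.wage g v) * P.hire g v ≤ h v * f g v) :
    ∫ v in Icc (0 : ℝ) 1, (v - P.wage g v) * P.hire g v ≤ ∫ v, h v ∂law (f g) := by
  rw [(hf g).integral_law]
  exact integral_mono_ae (P.integrableOn_profit hf g) ((hf g).integrable_law_iff.1 hh) hle

/-- A violation is separated by rationals `p < q`, and for each such pair `equal_pay` makes one of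
the two offending sets null; there are countably many pairs. Both orders of the almost-everywhere
quantifiers are recorded because a representative worker will be fixed in either group. -/
theorem FirmOutcome.ae_ae_wage_le (P : FirmOutcome f) (g : WorkerGroup) :
    (∀ᵐ v ∂volume.restrict (Icc (0 : ℝ) 1), ∀ᵐ v' ∂volume.restrict (Icc (0 : ℝ) 1),
      0 < P.hire g v → 0 < P.hire g.other v' → P.wage g.other v' ≤ P.wage g v) ∧
    (∀ᵐ v' ∂volume.restrict (Icc (0 : ℝ) 1), ∀ᵐ v ∂volume.restrict (Icc (0 : ℝ) 1),
      0 < P.hire g v → 0 < P.hire g.other v' → P.wage g.other v' ≤ P.wage g v) := by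
  have key (p q : ℚ) (hpq : p < q) :
      (∀ᵐ v ∂volume.restrict (Icc (0 : ℝ) 1), 0 < P.hire g v → ¬ P.wage g v ≤ p) ∨
      (∀ᵐ v ∂volume.restrict (Icc (0 : ℝ) 1), 0 < P.hire g.other v →
        ¬ (q : ℝ) ≤ P.wage g.other v) := by
    by_contra! hcon
    obtain ⟨h1, h2⟩ := hcon
    have m1 : MeasurableSet {v | 0 < P.hire g v ∧ P.wage g v ≤ p} :=
      (measurableSet_lt measurable_const (P.measurable_hire g)).inter
        (measurableSet_le (P.measurable_wage g) measurable_const)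
    have m2 : MeasurableSet {v | 0 < P.hire g.other v ∧ (q : ℝ) ≤ P.wage g.other v} :=
      (measurableSet_lt measurable_const (P.measurable_hire _)).inter
        (measurableSet_le measurable_const (P.measurable_wage _))
    refine P.equal_pay g ⟨Icc 0 1 ∩ {v | 0 < P.hire g v ∧ P.wage g v ≤ p},
      Icc 0 1 ∩ {v | 0 < P.hire g.other v ∧ (q : ℝ) ≤ P.wage g.other v},
      ⟨inter_subset_left, measurableSet_Icc.inter m1, ?_⟩,
      ⟨inter_subset_left, measurableSet_Icc.inter m2, ?_⟩,
      fun v hv => hv.2.1, fun v hv => hv.2.1, p, q, by exact_mod_cast hpq,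
      fun v hv => hv.2.2, fun v hv => hv.2.2⟩
    · rw [inter_comm, ← Measure.restrict_apply m1, pos_iff_ne_zero]
      intro h0
      exact h1 ((ae_iff.2 (by simpa using h0)))
    · rw [inter_comm, ← Measure.restrict_apply m2, pos_iff_ne_zero]
      intro h0
      exact h2 ((ae_iff.2 (by simpa using h0)))
  have lift {v v' : ℝ}
      (h : ∀ p q : ℚ, p < q → 0 < P.hire g v → 0 < P.hire g.other v' →
        ¬ (P.wage g v ≤ p ∧ q ≤ P.wage g.other v')) :
      0 < P.hire g v → 0 < P.hire g.other v' → P.wage g.other v' ≤ P.wage g v := by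
    intro hv hv'
    by_contra! hlt
    obtain ⟨p, hp, hp'⟩ := exists_rat_btwn hlt
    obtain ⟨q, hq, hq'⟩ := exists_rat_btwn hp'
    exact h p q (by exact_mod_cast hq) hv hv' ⟨hp.le, hq'.le⟩
  constructor
  · have : ∀ᵐ v ∂volume.restrict (Icc (0 : ℝ) 1), ∀ p q : ℚ, p < q →
        ∀ᵐ v' ∂volume.restrict (Icc (0 : ℝ) 1), 0 < P.hire g v → 0 < P.hire g.other v' →
        ¬ (P.wage g v ≤ p ∧ q ≤ P.wage g.other v') := by
      refine ae_all_iff.2 fun p => ae_all_iff.2 fun q => ?_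
      by_cases hpq : p < q
      · rcases key p q hpq with h | h
        · filter_upwards [h] with v hv _
          exact Filter.Eventually.of_forall fun v' h1 _ h3 => hv h1 h3.1
        · refine Filter.Eventually.of_forall fun v _ => ?_
          filter_upwards [h] with v' hv' _ h2 h3 using hv' h2 h3.2
      · exact Filter.Eventually.of_forall fun v h => absurd h hpq
    filter_upwards [this] with v hv
    have := ae_all_iff.2 fun p => ae_all_iff.2 fun q => ae_all_iff.2 fun h => hv p q h
    filter_upwards [this] with v' hv' using lift hv'
  · have : ∀ᵐ v' ∂volume.restrict (Icc (0 : ℝ) 1), ∀ p q : ℚ, p < q →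
        ∀ᵐ v ∂volume.restrict (Icc (0 : ℝ) 1), 0 < P.hire g v → 0 < P.hire g.other v' →
        ¬ (P.wage g v ≤ p ∧ q ≤ P.wage g.other v') := by
      refine ae_all_iff.2 fun p => ae_all_iff.2 fun q => ?_
      by_cases hpq : p < q
      · rcases key p q hpq with h | h
        · refine Filter.Eventually.of_forall fun v' _ => ?_
          filter_upwards [h] with v hv h1 _ h3 using hv h1 h3.1
        · filter_upwards [h] with v' hv' _
          exact Filter.Eventually.of_forall fun v _ h2 h3 => hv' h2 h3.2
      · exact Filter.Eventually.of_forall fun v h => absurd h hpq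
    filter_upwards [this] with v' hv'
    have := ae_all_iff.2 fun p => ae_all_iff.2 fun q => ae_all_iff.2 fun h => hv' p q h
    filter_upwards [this] with v hv using lift hv

/-- A firm that hires from both groups pays almost all of its workers the same wage. -/
theorem FirmOutcome.exists_common_wage (P : FirmOutcome f)
    (h : ∀ g, ¬ ∀ᵐ v ∂volume.restrict (Icc (0 : ℝ) 1), ¬ 0 < P.hire g v) :
    ∃ c, ∀ g, ∀ᵐ v ∂volume.restrict (Icc (0 : ℝ) 1), 0 < P.hire g v → P.wage g v = c := by
  obtain ⟨h1, h2⟩ := P.ae_ae_wage_le .A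
  obtain ⟨h3, h4⟩ := P.ae_ae_wage_le .B
  obtain ⟨v, hv, h1v, h4v⟩ := ((Filter.not_eventually.1 (h .A)).and_eventually
    (h1.and h4)).exists
  have hB : ∀ᵐ v' ∂volume.restrict (Icc (0 : ℝ) 1), 0 < P.hire .B v' →
      P.wage .B v' = P.wage .A v := by
    filter_upwards [h1v, h4v] with v' h h' hpos
    exact le_antisymm (h (not_not.1 hv) hpos) (h' hpos (not_not.1 hv))
  obtain ⟨v', hv', h2v, h3v, hBv⟩ := ((Filter.not_eventually.1 (h .B)).and_eventually
    (h2.and (h3.and hB))).exists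
  refine ⟨P.wage .A v, fun g => ?_⟩
  cases g with
  | A =>
    filter_upwards [h2v, h3v] with x h h' hpos
    rw [← hBv (not_not.1 hv')]
    exact le_antisymm (h' (not_not.1 hv') hpos) (h hpos (not_not.1 hv'))
  | B => exact hB

/-! ### Segregated core outcomes in terms of wage functions -/

/-- The conditions on wage functions under which the segregated outcome, in which one firm hires
each group, is a core outcome. -/
structure Supports (β : ℝ) (f w : WorkerGroup → ℝ → ℝ) : Prop where
  mono : ∀ g, Monotone (w g)
  nonneg : ∀ g v, 0 ≤ w g v
  le : ∀ g, ∀ v ∈ Ico (0 : ℝ) 1, w g v ≤ v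
  profit_eq : β * ∫ v, v - w .A v ∂law (f .A) = ∫ v, v - w .B v ∂law (f .B)
  surplus_le : ∀ c, β * surplus (f .A) (w .A) c + surplus (f .B) (w .B) c ≤
    ∫ v, v - w .B v ∂law (f .B)

theorem ae_mem_Ico : ∀ᵐ v ∂volume.restrict (Icc (0 : ℝ) 1), v ∈ Ico (0 : ℝ) 1 := by
  filter_upwards [ae_restrict_mem measurableSet_Icc, Measure.ae_ne _ (1 : ℝ)] with v hv hv1
  exact ⟨hv.1, lt_of_le_of_ne hv.2 hv1⟩

theorem FirmOutcome.integral_profit_le_own (hf : ∀ g, IsProductivityDensity (f g))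
    (P : FirmOutcome f) (g : WorkerGroup) {w : ℝ → ℝ} (hw : Monotone w)
    (hle : ∀ v ∈ Ico (0 : ℝ) 1, w v ≤ v)
    (hP : ∀ᵐ v ∂volume.restrict (Icc (0 : ℝ) 1), P.hire g v = 0 ∨ w v ≤ P.wage g v) :
    ∫ v in Icc (0 : ℝ) 1, (v - P.wage g v) * P.hire g v ≤ ∫ v, v - w v ∂law (f g) := by
  refine P.integral_profit_le hf g (integrable_sub_wage (hf g) hw) ?_
  filter_upwards [hP, ae_mem_Ico] with v hv hv1
  have h1 := P.hire_mem g v (Ico_subset_Icc_self hv1)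
  have h2 := hle v hv1
  have h3 : (v - w v) * P.hire g v ≤ (v - w v) * f g v :=
    mul_le_mul_of_nonneg_left h1.2 (by linarith)
  rcases hv with hv | hv
  · rw [hv] at h3 ⊢
    simpa using h3
  · exact (mul_le_mul_of_nonneg_right (by linarith) h1.1).trans h3

theorem FirmOutcome.integral_profit_nonpos
    (P : FirmOutcome f) (g : WorkerGroup)
    (hP : ∀ᵐ v ∂volume.restrict (Icc (0 : ℝ) 1), ¬ 0 < P.hire g v) :
    ∫ v in Icc (0 : ℝ) 1, (v - P.wage g v) * P.hire g v ≤ 0 := by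
  refine integral_nonpos_of_ae ?_
  filter_upwards [hP, ae_restrict_mem measurableSet_Icc] with v hv hv1
  have h1 := P.hire_mem g v hv1
  simp [le_antisymm (not_lt.1 hv) h1.1]

/-- The workers hired at `c` have current wage at most `c`, whereas `surplus` counts only wages
strictly below its argument; the slack `ε` absorbs the ties. -/
theorem FirmOutcome.integral_profit_le_common (hf : ∀ g, IsProductivityDensity (f g))
    (P : FirmOutcome f) (g : WorkerGroup) {w : ℝ → ℝ} (hw : Monotone w) {c : ℝ}
    (hc : ∀ᵐ v ∂volume.restrict (Icc (0 : ℝ) 1), 0 < P.hire g v → P.wage g v = c)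
    (hP : ∀ᵐ v ∂volume.restrict (Icc (0 : ℝ) 1), P.hire g v = 0 ∨ w v ≤ P.wage g v)
    {ε : ℝ} (hε : 0 < ε) :
    ∫ v in Icc (0 : ℝ) 1, (v - P.wage g v) * P.hire g v ≤ surplus (f g) w (c + ε) + ε := by
  refine (P.integral_profit_le hf g (h := {v | w v ≤ c}.indicator fun v => max (v - c) 0) ?_ ?_).trans
    (integral_wage_le_le_surplus_add (hf g) hw c hε)
  · refine (integrable_law_of_bound (hf g) (g := fun v => max (v - c) 0) (by fun_prop) (1 + |c|)
      fun v hv => ?_).indicator (measurableSet_le hw.measurable measurable_const)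
    have h1 := neg_abs_le c
    have h2 := abs_nonneg c
    rw [abs_of_nonneg (le_max_right _ _)]
    exact max_le (by linarith [hv.2]) (by linarith)
  · filter_upwards [hc, hP, ae_restrict_mem measurableSet_Icc] with v h1 h2 hv
    have h3 := P.hire_mem g v hv
    have h4 : 0 ≤ {v | w v ≤ c}.indicator (fun v => max (v - c) 0) v :=
      indicator_nonneg (fun _ _ => le_max_right _ _) v
    rcases h3.1.eq_or_lt with h0 | h0
    · rw [← h0, mul_zero]
      exact mul_nonneg h4 ((hf g).pos hv).le
    · have hw : w v ≤ c := by
        rw [← h1 h0]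
        exact h2.resolve_left h0.ne'
      rw [h1 h0, indicator_of_mem (s := {v | w v ≤ c}) hw]
      exact mul_le_mul (le_max_left _ _) h3.2 h0.le (le_max_right _ _)

theorem Supports.profit_le {β : ℝ} (hβ : 0 < β) (hf : ∀ g, IsProductivityDensity (f g))
    {w : WorkerGroup → ℝ → ℝ} (hw : Supports β f w) (P : FirmOutcome f)
    (hP : ∀ g, ∀ᵐ v ∂volume.restrict (Icc (0 : ℝ) 1), P.hire g v = 0 ∨ w g v ≤ P.wage g v) :
    P.profit β ≤ ∫ v, v - w .B v ∂law (f .B) := by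
  have own g := P.integral_profit_le_own hf g (hw.mono g) (hw.le g) (hP g)
  rw [P.profit_eq]
  by_cases hA : ∀ᵐ v ∂volume.restrict (Icc (0 : ℝ) 1), ¬ 0 < P.hire .A v
  · linarith [mul_le_mul_of_nonneg_left (P.integral_profit_nonpos .A hA) hβ.le, own .B]
  by_cases hB : ∀ᵐ v ∂volume.restrict (Icc (0 : ℝ) 1), ¬ 0 < P.hire .B v
  · linarith [mul_le_mul_of_nonneg_left (own .A) hβ.le, hw.profit_eq,
      P.integral_profit_nonpos .B hB]
  obtain ⟨c, hc⟩ := P.exists_common_wage (fun g => by cases g <;> assumption)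
  refine le_of_forall_pos_le_add fun ε hε => ?_
  -- Group `A` contributes the slack `β` times and group `B` once, hence the divisor `β + 1`.
  have hδ : 0 < ε / (β + 1) := by positivity
  have h g := P.integral_profit_le_common hf g (hw.mono g) (hc g) (hP g) hδ
  have hε' : β * (ε / (β + 1)) + ε / (β + 1) = ε := by field_simp
  linarith [mul_le_mul_of_nonneg_left (h .A) hβ.le, h .B, hw.surplus_le (c + ε / (β + 1))]

/-- The productivities at which a firm hires in the segregated outcome. -/
def staff : Firm → WorkerGroup → Set ℝ
  | .one, .A => univ
  | .one, .B => ∅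
  | .two, .A => ∅
  | .two, .B => univ

theorem measurableSet_staff (j : Firm) (g : WorkerGroup) : MeasurableSet (staff j g) := by
  cases j <;> cases g <;> simp [staff]

theorem exists_staff_eq_empty (j : Firm) : ∃ g, staff j g = ∅ := by
  cases j
  exacts [⟨.B, rfl⟩, ⟨.A, rfl⟩]

theorem Supports.existsCore {β : ℝ} (hβ : 0 < β) (hf : ∀ g, IsProductivityDensity (f g))
    {w : WorkerGroup → ℝ → ℝ} (hw : Supports β f w) {w₂ : ℝ → ℝ}
    (h2 : ∀ v ∈ Icc (0 : ℝ) 1, w .B v = w₂ v) : ExistsCoreWithBWages β f w₂ := by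
  let O : Outcome f :=
    { firm := fun j => .ofWages hf (staff j) (measurableSet_staff j) w hw.mono hw.nonneg
        (.inl (exists_staff_eq_empty j))
      feasible := fun g v _ => by cases g <;> simp [FirmOutcome.ofWages, staff] }
  have hprofit (j : Firm) : (O.firm j).profit β = ∫ v, v - w .B v ∂law (f .B) := by
    refine (FirmOutcome.profit_ofWages hf (measurableSet_staff j) hw.mono hw.nonneg
      (.inl (exists_staff_eq_empty j)) β).trans ?_
    cases j <;> simp [staff, hw.profit_eq]
  refine ⟨O, ?_, fun v _ => ?_, fun v _ => ?_, fun v hv => ?_⟩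
  · rintro ⟨j, P, hlt, hb⟩
    rw [hprofit] at hlt
    refine hlt.not_ge (hw.profit_le hβ hf P fun g => ?_)
    -- One firm employs all workers of type `v` and pays them `w g v`; the other hires none. So each
    -- of the four blocking clauses either gives a wage of at least `w g v` or leaves no worker to
    -- hire.
    filter_upwards [hb g, ae_restrict_mem measurableSet_Icc] with v h hv
    have h0 := (P.hire_mem g v hv).1
    have h1 := hw.nonneg g v
    cases j <;> cases g <;>
      simp only [O, FirmOutcome.ofWages, staff, Firm.other, indicator_univ, indicator_empty] at h <;>
      rcases h with h | h | h | h <;>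
      first
        | exact .inr (by linarith [h.1, h.2])
        | exact .inl (by linarith [h.2])
        | exact .inl (by linarith)
  · simp [O, FirmOutcome.ofWages, staff]
  · simp [O, FirmOutcome.ofWages, staff]
  · simp [O, FirmOutcome.ofWages, staff, h2 v hv]

/-- The function on the line that agrees with `w` on `[0,1]` and is constant on both sides. -/
noncomputable def clampExtend (w : ℝ → ℝ) : ℝ → ℝ :=
  IccExtend zero_le_one fun v : Icc (0 : ℝ) 1 => w v

theorem clampExtend_of_mem (w : ℝ → ℝ) {v : ℝ} (hv : v ∈ Icc (0 : ℝ) 1) : clampExtend w v = w v :=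
  IccExtend_of_mem _ _ hv

theorem monotone_clampExtend {w : ℝ → ℝ} (hw : MonotoneOn w (Icc 0 1)) :
    Monotone (clampExtend w) :=
  Monotone.IccExtend _ fun x y h => hw x.2 y.2 h

theorem clampExtend_nonneg {w : ℝ → ℝ} (hw : ∀ v ∈ Icc (0 : ℝ) 1, 0 ≤ w v) (v : ℝ) :
    0 ≤ clampExtend w v :=
  hw _ (projIcc 0 1 zero_le_one v).2

/-- Each condition in `Supports` that is not immediate is extracted by ruling out one specific
deviation, all of the form treated in `hblock`. -/
theorem Outcome.IsCore.exists_supports {β : ℝ} (hβ : 0 < β)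
    (hf : ∀ g, IsProductivityDensity (f g)) {w₂ : ℝ → ℝ} (hw₂ : IsWageFunction w₂)
    (hle : ∀ v ∈ Ico (0 : ℝ) 1, w₂ v ≤ v) {O : Outcome f} (hO : O.IsCore β)
    (h1 : ∀ v ∈ Icc (0 : ℝ) 1, (O.firm .one).hire .A v = f .A v)
    (h2 : ∀ v ∈ Icc (0 : ℝ) 1, (O.firm .two).hire .B v = f .B v)
    (hw : ∀ v ∈ Icc (0 : ℝ) 1, (O.firm .two).wage .B v = w₂ v) :
    ∃ w, Supports β f w ∧ w .B = clampExtend w₂ := by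
  let w : WorkerGroup → ℝ → ℝ
    | .A => clampExtend ((O.firm .one).wage .A)
    | .B => clampExtend w₂
  have hmono (g) : Monotone (w g) := by
    cases g with
    | A =>
      exact monotone_clampExtend fun v hv v' hv' hvv' =>
        (O.firm .one).wage_mono .A v' hv' v hv hvv' (by rw [h1 v' hv']; exact (hf .A).pos hv')
    | B => exact monotone_clampExtend hw₂.mono
  have hnonneg (g v) : 0 ≤ w g v := by
    cases g with
    | A => exact clampExtend_nonneg ((O.firm .one).wage_nonneg .A) v
    | B => exact clampExtend_nonneg hw₂.nonneg v
  have hwA {v} (hv : v ∈ Icc (0 : ℝ) 1) : (O.firm .one).wage .A v = w .A v :=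
    (clampExtend_of_mem _ hv).symm
  have hwB {v} (hv : v ∈ Icc (0 : ℝ) 1) : (O.firm .two).wage .B v = w .B v := by
    rw [hw v hv]; exact (clampExtend_of_mem _ hv).symm
  have hhB {v} (hv : v ∈ Icc (0 : ℝ) 1) : (O.firm .one).hire .B v = 0 :=
    le_antisymm (by linarith [O.feasible .B v hv, h2 v hv]) ((O.firm .one).hire_mem .B v hv).1
  have hhA {v} (hv : v ∈ Icc (0 : ℝ) 1) : (O.firm .two).hire .A v = 0 :=
    le_antisymm (by linarith [O.feasible .A v hv, h1 v hv]) ((O.firm .two).hire_mem .A v hv).1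
  have hwB0 {v} (hv : v ∈ Icc (0 : ℝ) 1) : (O.firm .one).wage .B v = 0 :=
    (O.firm .one).wage_eq_zero .B v hv (hhB hv)
  have hwA0 {v} (hv : v ∈ Icc (0 : ℝ) 1) : (O.firm .two).wage .A v = 0 :=
    (O.firm .two).wage_eq_zero .A v hv (hhA hv)
  have hp1 : (O.firm .one).profit β = β * ∫ v, v - w .A v ∂law (f .A) := by
    rw [FirmOutcome.profit_eq, (hf .A).integral_law]
    have e1 : ∫ v in Icc (0 : ℝ) 1, (v - (O.firm .one).wage .B v) * (O.firm .one).hire .B v = 0 :=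
      setIntegral_eq_zero_of_forall_eq_zero fun v hv => by rw [hhB hv, mul_zero]
    rw [e1, add_zero]
    congr 1
    exact setIntegral_congr_fun measurableSet_Icc fun v hv => by simp only [hwA hv, h1 v hv]
  have hp2 : (O.firm .two).profit β = ∫ v, v - w .B v ∂law (f .B) := by
    rw [FirmOutcome.profit_eq, (hf .B).integral_law]
    have e1 : ∫ v in Icc (0 : ℝ) 1, (v - (O.firm .two).wage .A v) * (O.firm .two).hire .A v = 0 :=
      setIntegral_eq_zero_of_forall_eq_zero fun v hv => by rw [hhA hv, mul_zero]
    rw [e1, mul_zero, zero_add]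
    exact setIntegral_congr_fun measurableSet_Icc fun v hv => by simp only [hwB hv, h2 v hv]
  have hblock (j : Firm) (S : WorkerGroup → Set ℝ) (hS : ∀ g, MeasurableSet (S g))
      (w' : WorkerGroup → ℝ → ℝ) (hw' : ∀ g, Monotone (w' g)) (hw0' : ∀ g v, 0 ≤ w' g v)
      (heq : (∃ g, S g = ∅) ∨ ∃ c, ∀ g v, w' g v = c)
      (hlt : ∀ g, ∀ v ∈ S g, w g v < w' g v ∨ staff j g = univ ∧ w g v ≤ w' g v) :
      β * (∫ v, (S .A).indicator (fun v => v - w' .A v) v ∂law (f .A)) +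
        ∫ v, (S .B).indicator (fun v => v - w' .B v) v ∂law (f .B) ≤ (O.firm j).profit β := by
    rw [← FirmOutcome.profit_ofWages hf hS hw' hw0' heq]
    by_contra! hcon
    refine hO ⟨j, _, hcon, fun g => ?_⟩
    filter_upwards [ae_restrict_mem measurableSet_Icc] with v hv
    simp only [FirmOutcome.ofWages]
    by_cases hvS : v ∈ S g
    · have h := hlt g v hvS
      have h' := hw0' g v
      simp only [indicator_of_mem hvS]
      cases j <;> cases g <;>
        simp only [Firm.other, staff, hwA hv, hwB hv, hhA hv, hhB hv, hwA0 hv,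
          hwB0 hv, true_and, empty_ne_univ, false_and, or_false] at h ⊢
      · exact .inr (.inl ⟨h.elim le_of_lt id, by simp⟩)
      · exact .inl ⟨h', h⟩
      · exact .inl ⟨h', h⟩
      · exact .inr (.inl ⟨h.elim le_of_lt id, by simp⟩)
    -- Where the deviation hires nobody, the last blocking clause holds by feasibility.
    · refine .inr (.inr (.inr ?_))
      rw [indicator_of_notMem hvS, zero_add]
      have := O.feasible g v hv
      cases j
      · exact this
      · rw [add_comm]; exact this
  have := (hf .A).isProbabilityMeasure
  have := (hf .B).isProbabilityMeasure
  -- Firm 1 could swap its workforce for that of firm 2 at wages raised by `ε`.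
  have hle12 : ∫ v, v - w .B v ∂law (f .B) ≤ β * ∫ v, v - w .A v ∂law (f .A) := by
    refine le_of_forall_pos_le_add fun ε hε => ?_
    have := hblock .one (staff .two) (measurableSet_staff _) (fun g v => w g v + ε)
      (fun g => (hmono g).add_const ε) (fun g v => add_nonneg (hnonneg g v) hε.le)
      (.inl (exists_staff_eq_empty _)) (fun g v _ => .inl (lt_add_of_pos_right _ hε))
    have e : ∫ v, v - (w .B v + ε) ∂law (f .B) = (∫ v, v - w .B v ∂law (f .B)) - ε := by
      simp_rw [← sub_sub]
      rw [integral_sub (integrable_sub_wage (hf .B) (hmono .B)) (integrable_const _)]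
      simp
    simp only [staff, indicator_empty, indicator_univ, integral_zero, mul_zero, zero_add, hp1,
      e] at this
    linarith
  have hle21 : β * ∫ v, v - w .A v ∂law (f .A) ≤ ∫ v, v - w .B v ∂law (f .B) := by
    refine le_of_forall_pos_le_add fun ε hε => ?_
    have hδ : 0 < ε / β := by positivity
    have := hblock .two (staff .one) (measurableSet_staff _) (fun g v => w g v + ε / β)
      (fun g => (hmono g).add_const _) (fun g v => add_nonneg (hnonneg g v) hδ.le)
      (.inl (exists_staff_eq_empty _)) (fun g v _ => .inl (lt_add_of_pos_right _ hδ))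
    have e : ∫ v, v - (w .A v + ε / β) ∂law (f .A) = (∫ v, v - w .A v ∂law (f .A)) - ε / β := by
      simp_rw [← sub_sub]
      rw [integral_sub (integrable_sub_wage (hf .A) (hmono .A)) (integrable_const _)]
      simp
    simp only [staff, indicator_empty, indicator_univ, integral_zero, add_zero, hp2,
      e] at this
    rw [mul_sub, mul_div_cancel₀ _ hβ.ne'] at this
    linarith
  have hsurplus (c : ℝ) : β * surplus (f .A) (w .A) c + surplus (f .B) (w .B) c ≤
      ∫ v, v - w .B v ∂law (f .B) := by
    have hind (g v) : ({v | w g v < c} ∩ {v | c ≤ v}).indicator (fun v => v - c) v =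
        {v | w g v < c}.indicator (fun v => max (v - c) 0) v := by
      rw [← indicator_indicator]
      by_cases hv : c ≤ v
      · by_cases hv' : w g v < c <;> simp [hv, hv']
      · by_cases hv' : w g v < c <;> simp [hv, hv', (not_le.1 hv).le]
    rcases le_or_gt c 0 with hc | hc
    · rw [surplus_of_nonpos (hnonneg .A) hc, surplus_of_nonpos (hnonneg .B) hc, mul_zero, add_zero]
      -- Hiring nobody is a possible deviation, so the profit is non-negative.
      have := hblock .two (fun _ => ∅) (fun _ => .empty) w hmono hnonneg (.inl ⟨.A, rfl⟩)
        (fun g v hv => hv.elim)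
      simpa [hp2] using this
    · have := hblock .two (fun g => {v | w g v < c} ∩ {v | c ≤ v}) (fun g =>
        (measurableSet_lt (hmono g).measurable measurable_const).inter measurableSet_Ici)
        (fun _ _ => c) (fun _ => monotone_const) (fun _ _ => hc.le) (.inr ⟨c, fun _ _ => rfl⟩)
        (fun g v hv => .inl hv.1)
      simpa only [surplus, hind .A, hind .B, hp2] using this
  have hleA : ∀ v ∈ Ico (0 : ℝ) 1, w .A v ≤ v := by
    have hm : MeasurableSet {v | w .A v ≤ v} := measurableSet_le (hmono .A).measurable measurable_id
    -- Firm 1 could keep only the workers who are paid at most their productivity. That this does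
    -- not raise its profit gives the inequality almost everywhere.
    have := hblock .one (fun g => match g with | .A => {v | w .A v ≤ v} | .B => ∅)
      (fun g => by cases g; exacts [hm, .empty]) w hmono hnonneg (.inl ⟨.B, rfl⟩)
      (fun g v hv => by cases g; exacts [.inr ⟨rfl, le_rfl⟩, hv.elim])
    simp only [indicator_empty, integral_zero, add_zero, hp1] at this
    have hi := integrable_sub_wage (hf .A) (hmono .A)
    have h0 : ∀ v, 0 ≤ {v | w .A v ≤ v}.indicator (fun v => v - w .A v) v - (v - w .A v) := by
      intro v
      by_cases hv : w .A v ≤ v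
      · rw [indicator_of_mem (s := {v | w .A v ≤ v}) hv, sub_self]
      · rw [indicator_of_notMem (s := {v | w .A v ≤ v}) hv]
        linarith [not_le.1 hv]
    have hae := (integral_eq_zero_iff_of_nonneg h0 ((hi.indicator hm).sub hi)).1 (by
      refine le_antisymm ?_ (integral_nonneg h0)
      rw [integral_sub (hi.indicator hm) hi, sub_nonpos]
      exact le_of_mul_le_mul_left this hβ)
    intro v hv
    by_contra! hlt
    -- By monotonicity, a violation at `v` persists on an interval to its right, which has positive
    -- mass.
    have hlt' : v < min (w .A v) 1 := lt_min hlt hv.2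
    refine ((hf .A).law_Ioc_pos hv.1 (left_lt_add_div_two.2 hlt')
      ((add_div_two_lt_right.2 hlt').le.trans (min_le_right _ _))).ne' (measure_mono_null ?_ hae)
    intro x hx
    have hx' : ¬ w .A x ≤ x := by
      have := hmono .A hx.1.le
      have := min_le_left (w .A v) 1
      have := add_div_two_lt_right.2 hlt'
      have := hx.2
      linarith
    intro h
    change {v | w .A v ≤ v}.indicator (fun v => v - w .A v) x - (x - w .A x) = 0 at h
    rw [indicator_of_notMem (s := {v | w .A v ≤ v}) hx'] at h
    linarith
  refine ⟨w, ⟨hmono, hnonneg, fun g v hv => ?_, le_antisymm hle21 hle12, hsurplus⟩, rfl⟩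
  cases g with
  | A => exact hleA v hv
  | B => exact (clampExtend_of_mem _ (Ico_subset_Icc_self hv)).trans_le (hle v hv)

/-! ### Scaling down profit and surplus together -/

section scaling

variable {f w : ℝ → ℝ}

theorem ae_law_mem_Ico (f : ℝ → ℝ) : ∀ᵐ v ∂law f, v ∈ Ico (0 : ℝ) 1 := by
  filter_upwards [ae_law_mem f, Measure.ae_ne _ (1 : ℝ)] with v hv hv1
  exact ⟨hv.1, lt_of_le_of_ne hv.2 hv1⟩

theorem IsProductivityDensity.law_real_Iic_sub (hf : IsProductivityDensity f) {a b : ℝ}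
    (hab : a ≤ b) : (law f).real (Iic b) - (law f).real (Iic a) = (law f).real (Ioc a b) := by
  have := hf.isProbabilityMeasure
  rw [← Iic_sdiff_Iic, measureReal_sdiff (Iic_subset_Iic.2 hab) measurableSet_Iic]

theorem IsProductivityDensity.continuous_law_Iic (hf : IsProductivityDensity f) :
    Continuous fun v => (law f).real (Iic v) := by
  have := hf.isProbabilityMeasure
  obtain ⟨u, hu0, hu⟩ := hf.exists_law_Ioc_le
  refine (LipschitzWith.of_le_add_mul ⟨u, hu0.le⟩ fun x y => ?_).continuous
  rcases le_total x y with h | h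
  · have : (law f).real (Iic x) ≤ (law f).real (Iic y) := measureReal_mono (Iic_subset_Iic.2 h)
    have : 0 ≤ u * dist x y := mul_nonneg hu0.le dist_nonneg
    change _ ≤ _ + u * dist x y
    linarith
  · have h1 := hf.law_real_Iic_sub h
    have h2 := hu y x h
    change _ ≤ _ + u * dist x y
    rw [Real.dist_eq, abs_of_nonneg (by linarith)]
    linarith

theorem IsProductivityDensity.law_Iic_lt (hf : IsProductivityDensity f) {a b : ℝ} (ha : 0 ≤ a)
    (hab : a < b) (hb : b ≤ 1) : (law f).real (Iic a) < (law f).real (Iic b) := by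
  have := hf.isProbabilityMeasure
  have h1 := hf.law_real_Iic_sub hab.le
  have : 0 < (law f).real (Ioc a b) :=
    ENNReal.toReal_pos (hf.law_Ioc_pos ha hab hb).ne' (measure_ne_top _ _)
  linarith

/-- A wage function for which, at every `c`, the measure of the workers with productivity at least
`c` and wage below `c` is `lam` times that for the wage function `w`. -/
theorem exists_scaled_wage (hf : IsProductivityDensity f) (hw : Monotone w)
    (hle : ∀ v ∈ Ico (0 : ℝ) 1, w v ≤ v) {lam : ℝ} (h0 : 0 ≤ lam) (h1 : lam ≤ 1) :
    ∃ w' : ℝ → ℝ, Monotone w' ∧ (∀ v, 0 ≤ w' v) ∧ (∀ v, 0 ≤ v → w' v ≤ v) ∧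
      ∀ c ∈ Icc (0 : ℝ) 1, ∃ y, c ≤ y ∧ (∀ v ∈ Icc c 1, w' v < c → v ≤ y) ∧
        (∀ v ∈ Icc c y, w' v ≤ c) ∧
        (law f).real (Icc c y) = lam * (law f).real {v | w v < c ∧ c ≤ v} := by
  have := hf.isProbabilityMeasure
  set F : ℝ → ℝ := fun v => (law f).real (Iic v) with hF
  set N : ℝ → ℝ := fun c => (law f).real {v | w v < c} with hN
  -- Chosen so that `Φ c - F c` is `lam` times the mass with `w v < c ≤ v`. The new wage is the
  -- generalized inverse of `Φ` at `F v`, and `y` solves `F y = Φ c`.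
  set Φ : ℝ → ℝ := fun c => (1 - lam) * F c + lam * N c with hΦ
  have hFmono : Monotone F := fun a b h => measureReal_mono (Iic_subset_Iic.2 h)
  have hNmono : Monotone N := fun a b h => measureReal_mono fun v hv => lt_of_lt_of_le hv h
  have hΦmono : Monotone Φ := fun a b h => add_le_add
    (mul_le_mul_of_nonneg_left (hFmono h) (by linarith)) (mul_le_mul_of_nonneg_left (hNmono h) h0)
  have hNF (c : ℝ) : N c = F c + (law f).real {v | w v < c ∧ c ≤ v} := by
    have hm : MeasurableSet {v | w v < c ∧ c ≤ v} :=
      (measurableSet_lt hw.measurable measurable_const).inter measurableSet_Ici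
    have hd : Disjoint (Iio c) {v | w v < c ∧ c ≤ v} :=
      disjoint_left.2 fun v hv hv' => (not_le.2 hv) hv'.2
    have h2 : (law f).real (Iio c) = F c := measureReal_congr Iio_ae_eq_Iic
    rw [← h2, ← measureReal_union hd hm]
    refine measureReal_congr ?_
    filter_upwards [ae_law_mem_Ico f] with v hv
    refine propext ⟨fun h => ?_, fun h => ?_⟩
    · rcases lt_or_ge v c with h' | h'
      exacts [.inl h', .inr ⟨h, h'⟩]
    · rcases h with h | h
      exacts [(hle v hv).trans_lt h, h.1]
  have hFΦ (c : ℝ) : F c ≤ Φ c := by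
    have : 0 ≤ lam * (law f).real {v | w v < c ∧ c ≤ v} := mul_nonneg h0 measureReal_nonneg
    simp only [hΦ, hNF c]
    linarith
  have hbdd (v : ℝ) : BddAbove {c | c ∈ Icc (0 : ℝ) 1 ∧ Φ c < F v} := ⟨1, fun c hc => hc.1.2⟩
  have hnonneg (v : ℝ) : 0 ≤ sSup {c | c ∈ Icc (0 : ℝ) 1 ∧ Φ c < F v} :=
    Real.sSup_nonneg fun c hc => hc.1.1
  refine ⟨fun v => sSup {c | c ∈ Icc (0 : ℝ) 1 ∧ Φ c < F v}, fun v v' h => ?_, hnonneg,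
    fun v hv => ?_, fun c hc => ?_⟩
  · exact Real.sSup_le (fun c hc => le_csSup (hbdd v') ⟨hc.1, hc.2.trans_le (hFmono h)⟩)
      (hnonneg v')
  · refine Real.sSup_le (fun c hc => ?_) hv
    exact (hFmono.reflect_lt ((hFΦ c).trans_lt hc.2)).le
  · have hF1 : F 1 = 1 := by
      have : Iic (1 : ℝ) =ᵐ[law f] univ := by
        filter_upwards [ae_law_mem f] with v hv
        exact propext ⟨fun _ => trivial, fun _ => hv.2⟩
      rw [hF]
      simp only [measureReal_congr this, probReal_univ]
    have hΦ1 : Φ c ≤ F 1 := by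
      have hN1 : N c ≤ 1 := measureReal_le_one
      have hF1' : F c ≤ 1 := measureReal_le_one
      rw [hF1]
      simp only [hΦ]
      nlinarith
    obtain ⟨y, hy, hyΦ⟩ := intermediate_value_Icc hc.2 hf.continuous_law_Iic.continuousOn
      ⟨hFΦ c, hΦ1⟩
    have hyΦ : F y = Φ c := hyΦ
    refine ⟨y, hy.1, fun v hv h => ?_, fun v hv => ?_, ?_⟩
    · by_contra! hlt
      have h' : Φ c < F v := hyΦ ▸ hf.law_Iic_lt (hc.1.trans hy.1) hlt hv.2
      exact h.not_ge (le_csSup (hbdd v) ⟨hc, h'⟩)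
    · refine Real.sSup_le (fun c' hc' => ?_) hc.1
      exact (hΦmono.reflect_lt (hc'.2.trans_le ((hFmono hv.2).trans hyΦ.le))).le
    · rw [← measureReal_congr Ioc_ae_eq_Icc, ← hf.law_real_Iic_sub hy.1]
      change F y - F c = _
      rw [hyΦ]
      simp only [hΦ, hNF c]
      ring

/-- Layer-cake formula: `v - w v` is the length of the set of `c` between `w v` and `v`. The strict
form here and the weak form below bracket the interval `Icc c y` of `exists_scaled_wage` from both
sides. -/
theorem lintegral_sub_wage_eq_lt (hf : IsProductivityDensity f) (hw : Monotone w)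
    (hw0 : ∀ v, 0 ≤ w v) : ∫⁻ v, ENNReal.ofReal (v - w v) ∂law f =
      ∫⁻ c in Icc (0 : ℝ) 1, law f {v | w v < c ∧ c ≤ v} := by
  have := hf.isProbabilityMeasure
  have hm := hw.measurable
  have hR : MeasurableSet {p : ℝ × ℝ | w p.1 < p.2 ∧ p.2 ≤ p.1} :=
    (measurableSet_lt (hm.comp measurable_fst) measurable_snd).inter
      (measurableSet_le measurable_snd measurable_fst)
  have h := (Measure.prod_apply (μ := law f) (ν := volume.restrict (Icc (0 : ℝ) 1)) hR).symm.trans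
    (Measure.prod_apply_symm hR)
  refine Eq.trans (lintegral_congr_ae ?_) h
  filter_upwards [ae_law_mem f] with v hv
  change _ = volume.restrict (Icc (0 : ℝ) 1) (Ioc (w v) v)
  rw [Measure.restrict_apply measurableSet_Ioc, inter_eq_left.2, Real.volume_Ioc]
  exact fun c hc => ⟨(hw0 v).trans hc.1.le, hc.2.trans hv.2⟩

theorem lintegral_sub_wage_eq_le (hf : IsProductivityDensity f) (hw : Monotone w)
    (hw0 : ∀ v, 0 ≤ w v) : ∫⁻ v, ENNReal.ofReal (v - w v) ∂law f =
      ∫⁻ c in Icc (0 : ℝ) 1, law f {v | w v ≤ c ∧ c ≤ v} := by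
  have := hf.isProbabilityMeasure
  have hm := hw.measurable
  have hR : MeasurableSet {p : ℝ × ℝ | w p.1 ≤ p.2 ∧ p.2 ≤ p.1} :=
    (measurableSet_le (hm.comp measurable_fst) measurable_snd).inter
      (measurableSet_le measurable_snd measurable_fst)
  have h := (Measure.prod_apply (μ := law f) (ν := volume.restrict (Icc (0 : ℝ) 1)) hR).symm.trans
    (Measure.prod_apply_symm hR)
  refine Eq.trans (lintegral_congr_ae ?_) h
  filter_upwards [ae_law_mem f] with v hv
  change _ = volume.restrict (Icc (0 : ℝ) 1) (Icc (w v) v)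
  rw [Measure.restrict_apply measurableSet_Icc, inter_eq_left.2, Real.volume_Icc]
  exact fun c hc => ⟨(hw0 v).trans hc.1, hc.2.trans hv.2⟩

theorem ofReal_integral_sub_wage (hf : IsProductivityDensity f) (hw : Monotone w)
    (hle : ∀ v ∈ Ico (0 : ℝ) 1, w v ≤ v) :
    ENNReal.ofReal (∫ v, v - w v ∂law f) = ∫⁻ v, ENNReal.ofReal (v - w v) ∂law f := by
  refine ofReal_integral_eq_lintegral_ofReal (integrable_sub_wage hf hw) ?_
  filter_upwards [ae_law_mem_Ico f] with v hv using sub_nonneg.2 (hle v hv)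

theorem integral_sub_wage_nonneg (hle : ∀ v ∈ Ico (0 : ℝ) 1, w v ≤ v) :
    0 ≤ ∫ v, v - w v ∂law f := by
  refine integral_nonneg_of_ae ?_
  filter_upwards [ae_law_mem_Ico f] with v hv using sub_nonneg.2 (hle v hv)

/-- Profits and poaching surpluses can be scaled down together. -/
theorem exists_wage_surplus_le (hf : IsProductivityDensity f) (hw : Monotone w)
    (hw0 : ∀ v, 0 ≤ w v) (hle : ∀ v ∈ Ico (0 : ℝ) 1, w v ≤ v) {lam : ℝ} (h0 : 0 ≤ lam)
    (h1 : lam ≤ 1) :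
    ∃ w' : ℝ → ℝ, Monotone w' ∧ (∀ v, 0 ≤ w' v) ∧ (∀ v ∈ Ico (0 : ℝ) 1, w' v ≤ v) ∧
      ∫ v, v - w' v ∂law f = lam * ∫ v, v - w v ∂law f ∧
      ∀ c, surplus f w' c ≤ lam * surplus f w c := by
  have := hf.isProbabilityMeasure
  obtain ⟨w', hw', hw0', hle', hy⟩ := exists_scaled_wage hf hw hle h0 h1
  refine ⟨w', hw', hw0', fun v hv => hle' v hv.1, ?_, fun c => ?_⟩
  · have hscale {c y : ℝ}
        (h : (law f).real (Icc c y) = lam * (law f).real {v | w v < c ∧ c ≤ v}) :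
        law f (Icc c y) = ENNReal.ofReal lam * law f {v | w v < c ∧ c ≤ v} := by
      rw [← ofReal_measureReal (μ := law f), h, ENNReal.ofReal_mul h0, ofReal_measureReal]
    have key : ∫⁻ v, ENNReal.ofReal (v - w' v) ∂law f =
        ENNReal.ofReal lam * ∫⁻ v, ENNReal.ofReal (v - w v) ∂law f := by
      rw [lintegral_sub_wage_eq_lt hf hw hw0, ← lintegral_const_mul' _ _ ENNReal.ofReal_ne_top]
      refine le_antisymm ?_ ?_
      · rw [lintegral_sub_wage_eq_lt hf hw' hw0']
        refine lintegral_mono_ae ?_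
        filter_upwards [ae_restrict_mem measurableSet_Icc] with c hc
        obtain ⟨y, -, hy1, -, hy3⟩ := hy c hc
        rw [← hscale hy3]
        refine measure_mono_ae ?_
        filter_upwards [ae_law_mem f] with v hv h
        exact ⟨h.2, hy1 v ⟨h.2, hv.2⟩ h.1⟩
      · rw [lintegral_sub_wage_eq_le hf hw' hw0']
        refine lintegral_mono_ae ?_
        filter_upwards [ae_restrict_mem measurableSet_Icc] with c hc
        obtain ⟨y, -, -, hy2, hy3⟩ := hy c hc
        rw [← hscale hy3]
        exact measure_mono fun v hv => ⟨hy2 v hv, hv.1⟩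
    rw [← ofReal_integral_sub_wage hf hw' fun v hv => hle' v hv.1,
      ← ofReal_integral_sub_wage hf hw hle, ← ENNReal.ofReal_mul h0] at key
    exact (ENNReal.ofReal_eq_ofReal_iff (integral_sub_wage_nonneg fun v hv => hle' v hv.1)
      (mul_nonneg h0 (integral_sub_wage_nonneg hle))).1 key
  · rcases le_or_gt c 0 with hc0 | hc0
    · rw [surplus_of_nonpos hw0' hc0, surplus_of_nonpos hw0 hc0, mul_zero]
    rcases le_or_gt 1 c with hc1 | hc1
    · rw [surplus_of_one_le hc1, surplus_of_one_le hc1, mul_zero]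
    obtain ⟨y, hcy, hy1, -, hy3⟩ := hy c ⟨hc0.le, hc1.le⟩
    have hm : MeasurableSet {v | w v < c ∧ c ≤ v} :=
      (measurableSet_lt hw.measurable measurable_const).inter measurableSet_Ici
    have i1 := (integrable_surplus hf hw c).const_mul lam
    have i2 : Integrable ((Icc c y).indicator fun _ => y - c) (law f) :=
      (integrable_const _).indicator measurableSet_Icc
    have i3 : Integrable ({v | w v < c ∧ c ≤ v}.indicator fun _ => lam * (y - c)) (law f) :=
      (integrable_const _).indicator hm
    have i23 : Integrable (fun v => (Icc c y).indicator (fun _ => y - c) v -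
        {v | w v < c ∧ c ≤ v}.indicator (fun _ => lam * (y - c)) v) (law f) := i2.sub i3
    -- Bathtub argument: the two sets have masses in ratio `lam`, so the correction with multiplier
    -- `y - c` integrates to zero. With it added, the inequality holds pointwise, since `v - c` is
    -- at most `y - c` on `Icc c y` and larger beyond.
    have e : ∫ v, (lam * {v | w v < c}.indicator (fun v => max (v - c) 0) v +
        ((Icc c y).indicator (fun _ => y - c) v -
          {v | w v < c ∧ c ≤ v}.indicator (fun _ => lam * (y - c)) v)) ∂law f =
        lam * surplus f w c := by
      have e2 : ∫ v, (Icc c y).indicator (fun _ => y - c) v ∂law f =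
          ∫ v, {v | w v < c ∧ c ≤ v}.indicator (fun _ => lam * (y - c)) v ∂law f := by
        rw [integral_indicator_const _ measurableSet_Icc, integral_indicator_const _ hm, hy3]
        simp only [smul_eq_mul]
        ring
      rw [integral_add i1 i23, integral_const_mul, integral_sub i2 i3, e2, sub_self,
        add_zero, surplus]
    rw [← e]
    refine integral_mono_ae (integrable_surplus hf hw' c) (i1.add i23) ?_
    filter_upwards [ae_law_mem f] with v hv
    rcases lt_or_ge v c with hvc | hvc
    · have : max (v - c) 0 = 0 := max_eq_right (by linarith)
      simp [indicator_apply, this, not_le.2 hvc]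
    · have hmax : max (v - c) 0 = v - c := max_eq_left (by linarith)
      have := hy1 v ⟨hvc, hv.2⟩
      simp only [indicator_apply, mem_ofPred_eq, mem_Icc, hvc, hmax, true_and, and_true]
      split_ifs <;> first | nlinarith | (exfalso; tauto)

end scaling

theorem Supports.exists_of_le {f w : WorkerGroup → ℝ → ℝ} {β β' : ℝ} (hβ : 0 < β)
    (h : β ≤ β') (hf : ∀ g, IsProductivityDensity (f g)) (hw : Supports β f w) :
    ∃ w', Supports β' f w' ∧ w' .B = w .B := by
  have hβ' : 0 < β' := hβ.trans_le h
  obtain ⟨w₁, h1, h2, h3, h4, h5⟩ := exists_wage_surplus_le (hf .A) (hw.mono .A) (hw.nonneg .A)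
    (hw.le .A) (lam := β / β') (by positivity) ((div_le_one hβ').2 h)
  refine ⟨fun | .A => w₁ | .B => w .B, ⟨fun g => ?_, fun g => ?_, fun g => ?_, ?_, fun c => ?_⟩, rfl⟩
  · cases g
    exacts [h1, hw.mono .B]
  · cases g
    exacts [h2, hw.nonneg .B]
  · cases g
    exacts [h3, hw.le .B]
  · rw [← hw.profit_eq]
    simp only [h4]
    field_simp
  · have h6 := mul_le_mul_of_nonneg_left (h5 c) hβ'.le
    rw [← mul_assoc, mul_div_cancel₀ _ hβ'.ne'] at h6
    have h7 := hw.surplus_le c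
    simp only
    linarith

/-! ### Existence of a supporting `β` -/

theorem surplus_le_one_sub {f w : ℝ → ℝ} (hf : IsProductivityDensity f) {a c : ℝ} (ha : a ≤ 1)
    (hc : a ≤ c) : surplus f w c ≤ 1 - a := by
  have := hf.isProbabilityMeasure
  have e : ∫ _, (1 - a) ∂law f = 1 - a := by simp
  rw [← e]
  refine integral_mono_of_nonneg (Filter.Eventually.of_forall fun _ =>
    indicator_nonneg (fun _ _ => le_max_right _ _) _) (integrable_const _) ?_
  filter_upwards [ae_law_mem f] with v hv
  exact indicator_apply_le' (fun _ => max_le (by linarith [hv.2]) (by linarith))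
    fun _ => by linarith

/-- A wage function that leaves a small profit, all of it on the workers with high productivity. -/
theorem exists_wage_small_surplus {f : ℝ → ℝ} (hf : IsProductivityDensity f) {a : ℝ} (ha : 0 ≤ a)
    (ha1 : a < 1) :
    ∃ w : ℝ → ℝ, Monotone w ∧ (∀ v, 0 ≤ w v) ∧ (∀ v ∈ Ico (0 : ℝ) 1, w v ≤ v) ∧
      0 < ∫ v, v - w v ∂law f ∧ (∀ c ≤ a, surplus f w c = 0) ∧
      ∀ c, surplus f w c ≤ (∫ v, v - w v ∂law f) / 2 := by
  have := hf.isProbabilityMeasure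
  obtain ⟨u, hu0, hu⟩ := hf.exists_law_Ioc_le
  obtain ⟨l, hl0, hl⟩ := hf.exists_le_law_Ioc
  have ha' : 0 < 1 - a := sub_pos.2 ha1
  -- The profit will be at least of order `δ`, namely `l * δ * (1 - a) / 2`, while each surplus is
  -- at most `u * δ ^ 2`; a small `δ` makes the ratio at most one half.
  obtain ⟨δ, hδ0, hδ1, hδ2⟩ : ∃ δ : ℝ, 0 < δ ∧ δ ≤ (1 - a) / 2 ∧ u * δ ≤ l * (1 - a) / 4 := by
    refine ⟨min ((1 - a) / 2) (l * (1 - a) / 4 / u), by positivity, min_le_left _ _, ?_⟩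
    calc _ ≤ u * (l * (1 - a) / 4 / u) := mul_le_mul_of_nonneg_left (min_le_right _ _) hu0.le
      _ = _ := by field_simp
  -- On `[0,1]` the wage is `v` up to `a`, then `a` up to `a + δ`, then `v - δ`.
  let w : ℝ → ℝ := fun v => max 0 (max (v - δ) (min v a))
  have hmono : Monotone w := fun x y h =>
    max_le_max le_rfl (max_le_max (by linarith) (min_le_min h le_rfl))
  have hle {v} (hv : 0 ≤ v) : w v ≤ v :=
    max_le hv (max_le (by linarith) (min_le_left _ _))
  have hH : l * δ * (1 - a) / 2 ≤ ∫ v, v - w v ∂law f := by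
    have e : ∫ v, (Ioc (a + δ) 1).indicator (fun _ => δ) v ∂law f =
        (law f).real (Ioc (a + δ) 1) * δ := by
      rw [integral_indicator_const _ measurableSet_Ioc, smul_eq_mul]
    have h1 := mul_le_mul_of_nonneg_right (hl (a + δ) 1 (by linarith) (by linarith) le_rfl) hδ0.le
    have h2 : ∫ v, (Ioc (a + δ) 1).indicator (fun _ => δ) v ∂law f ≤ ∫ v, v - w v ∂law f := by
      refine integral_mono_ae ((integrable_const _).indicator measurableSet_Ioc)
        (integrable_sub_wage hf hmono) ?_
      filter_upwards [ae_law_mem f] with v hv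
      refine indicator_apply_le' (fun h => ?_) fun _ => sub_nonneg.2 (hle hv.1)
      have : w v ≤ v - δ := max_le (by linarith [h.1])
        (max_le le_rfl ((min_le_right _ _).trans (by linarith [h.1])))
      linarith
    have h3 : l * δ * (1 - a) / 2 ≤ l * (1 - (a + δ)) * δ := by
      have : 0 ≤ l * δ * ((1 - a) / 2 - δ) := mul_nonneg (by positivity) (by linarith)
      linarith
    linarith
  have hpos : 0 < l * δ * (1 - a) / 2 := by positivity
  refine ⟨w, hmono, fun v => le_max_left _ _, fun v hv => hle hv.1, hpos.trans_le hH,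
    fun c hc => ?_, fun c => ?_⟩
  · refine integral_eq_zero_of_ae (Filter.Eventually.of_forall fun v => ?_)
    by_cases h : w v < c
    · rw [indicator_of_mem (s := {v | w v < c}) h]
      have h1 : min v a < c := ((le_max_right _ _).trans (le_max_right _ _)).trans_lt h
      have h2 : v < c := (min_lt_iff.1 h1).resolve_right (not_lt.2 hc)
      exact max_eq_right (by linarith)
    · rw [indicator_of_notMem (s := {v | w v < c}) h]; rfl
  · have e : ∫ v, (Ioc c (c + δ)).indicator (fun _ => δ) v ∂law f =
        (law f).real (Ioc c (c + δ)) * δ := by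
      rw [integral_indicator_const _ measurableSet_Ioc, smul_eq_mul]
    have h1 := mul_le_mul_of_nonneg_right (hu c (c + δ) (by linarith)) hδ0.le
    have h2 : surplus f w c ≤ ∫ v, (Ioc c (c + δ)).indicator (fun _ => δ) v ∂law f := by
      refine integral_mono (integrable_surplus hf hmono c)
        ((integrable_const _).indicator measurableSet_Ioc) fun v => ?_
      refine indicator_apply_le' (fun h => ?_) fun _ => indicator_nonneg (fun _ _ => hδ0.le) v
      have h3 : v - δ < c := ((le_max_left _ _).trans (le_max_right _ _)).trans_lt h
      rcases le_or_gt v c with hv | hv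
      · exact (max_eq_right (by linarith)).trans_le (indicator_nonneg (fun _ _ => hδ0.le) v)
      · rw [indicator_of_mem (show v ∈ Ioc c (c + δ) from ⟨hv, by linarith⟩)]
        exact max_le (by linarith) hδ0.le
    have h3 := mul_le_mul_of_nonneg_right hδ2 hδ0.le
    have h4 : u * (c + δ - c) * δ = u * δ * δ := by ring
    have h5 : l * (1 - a) / 4 * δ = l * δ * (1 - a) / 2 / 2 := by ring
    linarith

theorem exists_supports (hf : ∀ g, IsProductivityDensity (f g)) {w₂ : ℝ → ℝ} (hw : Monotone w₂)
    (hw0 : ∀ v, 0 ≤ w₂ v) (hle : ∀ v ∈ Ico (0 : ℝ) 1, w₂ v ≤ v)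
    (hs : ∀ c, surplus (f .B) w₂ c ≤ ∫ v, v - w₂ v ∂law (f .B)) :
    ∃ β, 0 < β ∧ ∃ w, Supports β f w ∧ w .B = w₂ := by
  rcases (integral_sub_wage_nonneg hle : 0 ≤ ∫ v, v - w₂ v ∂law (f .B)).eq_or_lt with h0 | hpos
  -- If the `B`-profit is zero, paying `A`-workers their productivity gives zero profit and surplus
  -- as well.
  · have hA (c : ℝ) : surplus (f .A) (fun v => max v 0) c = 0 := by
      refine integral_eq_zero_of_ae (Filter.Eventually.of_forall fun v => ?_)
      by_cases h : max v 0 < c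
      · rw [indicator_of_mem (s := {v | max v 0 < c}) h]
        exact max_eq_right (by linarith [le_max_left v 0])
      · rw [indicator_of_notMem (s := {v | max v 0 < c}) h]; rfl
    refine ⟨1, one_pos, fun | .A => fun v => max v 0 | .B => w₂,
      ⟨fun g => ?_, fun g => ?_, fun g => ?_, ?_, fun c => ?_⟩, rfl⟩
    · cases g
      exacts [fun x y h => max_le_max h le_rfl, hw]
    · cases g
      exacts [fun v => le_max_right _ _, hw0]
    · cases g
      exacts [fun v hv => max_le le_rfl hv.1, hle]
    · simp only
      rw [← h0, integral_eq_zero_of_ae, mul_zero]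
      filter_upwards [ae_law_mem (f .A)] with v hv
      simp [hv.1]
    · simp only
      rw [hA, mul_zero, zero_add]
      exact hs c
  -- The cutoff splits the wages `c`: up to it group `A` gives no surplus, and beyond it each group
  -- contributes at most half of the `B`-profit.
  · obtain ⟨w₁, h1, h2, h3, h4, h5, h6⟩ := exists_wage_small_surplus (hf .A)
      (le_max_left 0 (1 - (∫ v, v - w₂ v ∂law (f .B)) / 2))
      (max_lt one_pos (by linarith))
    refine ⟨(∫ v, v - w₂ v ∂law (f .B)) / ∫ v, v - w₁ v ∂law (f .A), div_pos hpos h4,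
      fun | .A => w₁ | .B => w₂, ⟨fun g => ?_, fun g => ?_, fun g => ?_, ?_, fun c => ?_⟩, rfl⟩
    · cases g
      exacts [h1, hw]
    · cases g
      exacts [h2, hw0]
    · cases g
      exacts [h3, hle]
    · simp only
      rw [div_mul_cancel₀ _ h4.ne']
    · simp only
      rcases le_or_gt c (max 0 (1 - (∫ v, v - w₂ v ∂law (f .B)) / 2)) with hc | hc
      · rw [h5 c hc, mul_zero, zero_add]
        exact hs c
      · have h7 := mul_le_mul_of_nonneg_left (h6 c) (div_pos hpos h4).le
        rw [← mul_div_assoc, div_mul_cancel₀ _ h4.ne'] at h7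
        have h8 := surplus_le_one_sub (w := w₂) (hf .B)
          (a := 1 - (∫ v, v - w₂ v ∂law (f .B)) / 2) (by linarith)
          ((le_max_right _ _).trans hc.le)
        linarith

/-! ### The threshold and the two cases of the theorem -/

/-- The supported `β` form a nonempty upward closed set, whose infimum is the threshold. The last
clause passes lower bounds on to it, for the positivity in the case of zero wages. -/
theorem exists_threshold (hf : ∀ g, IsProductivityDensity (f g)) {w₂ : ℝ → ℝ}
    (hw : IsWageFunction w₂) (hle : ∀ v ∈ Ico (0 : ℝ) 1, w₂ v ≤ v)
    (hs : ∀ c, surplus (f .B) (clampExtend w₂) c ≤ ∫ v, v - clampExtend w₂ v ∂law (f .B)) :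
    ∃ βs, 0 ≤ βs ∧ IsThreshold f w₂ βs ∧
      ∀ b, (∀ β w, 0 < β → Supports β f w → w .B = clampExtend w₂ → b ≤ β) → b ≤ βs := by
  let T : Set ℝ := {β | 0 < β ∧ ExistsCoreWithBWages β f w₂}
  have hsupp {β} (h : β ∈ T) : ∃ w, Supports β f w ∧ w .B = clampExtend w₂ := by
    obtain ⟨h0, O, hO, h1, h2, h3⟩ := h
    exact hO.exists_supports h0 hf hw hle h1 h2 h3
  have hcore {β w} (h0 : 0 < β) (h : Supports β f w) (hB : w .B = clampExtend w₂) :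
      ExistsCoreWithBWages β f w₂ :=
    h.existsCore h0 hf fun v hv => by rw [hB, clampExtend_of_mem _ hv]
  have hne : T.Nonempty := by
    obtain ⟨β, h0, w, h, hB⟩ := exists_supports hf (monotone_clampExtend hw.mono)
      (clampExtend_nonneg hw.nonneg)
      (fun v hv => (clampExtend_of_mem _ (Ico_subset_Icc_self hv)).trans_le (hle v hv)) hs
    exact ⟨β, h0, hcore h0 h hB⟩
  have hbdd : BddBelow T := ⟨0, fun β h => h.1.le⟩
  refine ⟨sInf T, Real.sInf_nonneg fun β h => h.1.le, ⟨fun β h0 h => ?_, fun β h0 h h' => ?_⟩,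
    fun b hb => ?_⟩
  · obtain ⟨β', hβ', hlt⟩ := exists_lt_of_csInf_lt hne h
    obtain ⟨w, hw', hB⟩ := hsupp hβ'
    obtain ⟨w', h1, h2⟩ := hw'.exists_of_le hβ'.1 hlt.le hf
    exact hcore h0 h1 (h2.trans hB)
  · exact h.not_ge (csInf_le hbdd ⟨h0, h'⟩)
  · refine le_csInf hne fun β hβ => ?_
    obtain ⟨w, hw', hB⟩ := hsupp hβ
    exact hb β w hβ.1 hw' hB

theorem IsProductivityDensity.intervalIntegral_sub_mul {f : ℝ → ℝ} (hf : IsProductivityDensity f)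
    {a b : ℝ} (ha : 0 ≤ a) (hab : a ≤ b) (hb : b ≤ 1) :
    ∫ v in a..b, (v - a) * f v = ∫ v, (Ioc a b).indicator (fun v => v - a) v ∂law f := by
  have e : (fun v => (Ioc a b).indicator (fun v => v - a) v * f v) =
      (Ioc a b).indicator fun v => (v - a) * f v := by
    funext v
    by_cases hv : v ∈ Ioc a b <;> simp [hv]
  rw [hf.integral_law, e, setIntegral_indicator measurableSet_Ioc, inter_eq_right.2,
    intervalIntegral.integral_of_le hab]
  exact fun v hv => ⟨ha.trans hv.1.le, hv.2.trans hb⟩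

theorem wageInv_mem {w : ℝ → ℝ} (hle : ∀ v ∈ Ico (0 : ℝ) 1, w v ≤ v) {c : ℝ}
    (hc : c ∈ Ico (0 : ℝ) 1) : c ≤ wageInv w c ∧ wageInv w c ≤ 1 :=
  ⟨le_csSup ⟨1, fun _ h => h.1.2⟩ ⟨Ico_subset_Icc_self hc, hle c hc⟩,
    csSup_le ⟨c, Ico_subset_Icc_self hc, hle c hc⟩ fun _ h => h.1.2⟩

/-- Workers with wage below `c` lie below `wageInv w₂ c`, so the surplus is at most the antitone
integral at `c`, hence at most its value at `0`. That value is the profit from the workers paid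
nothing, a part of the whole profit. -/
theorem surplus_le_of_antitoneOn {f : ℝ → ℝ} (hf : IsProductivityDensity f) {w₂ : ℝ → ℝ}
    (hw : IsWageFunction w₂) (hle : ∀ v ∈ Ico (0 : ℝ) 1, w₂ v ≤ v)
    (hanti : AntitoneOn (fun c : ℝ => ∫ v in c..(wageInv w₂ c), (v - c) * f v) (Icc 0 1))
    (c : ℝ) : surplus f (clampExtend w₂) c ≤ ∫ v, v - clampExtend w₂ v ∂law f := by
  have hle' : ∀ v ∈ Ico (0 : ℝ) 1, clampExtend w₂ v ≤ v := fun v hv =>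
    (clampExtend_of_mem _ (Ico_subset_Icc_self hv)).trans_le (hle v hv)
  have hmono := monotone_clampExtend hw.mono
  have h0 : 0 ≤ ∫ v, v - clampExtend w₂ v ∂law f := integral_sub_wage_nonneg hle'
  rcases le_or_gt c 0 with hc0 | hc0
  · rwa [surplus_of_nonpos (clampExtend_nonneg hw.nonneg) hc0]
  rcases le_or_gt 1 c with hc1 | hc1
  · rwa [surplus_of_one_le hc1]
  have hint (a b : ℝ) : Integrable ((Ioc a b).indicator fun v => v - a) (law f) :=
    (integrable_law_of_bound hf (g := fun v => v - a) (by fun_prop) (1 + |a|) fun v hv =>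
      (abs_sub _ _).trans (add_le_add_left (abs_le.2 ⟨by linarith [hv.1], hv.2⟩) _)).indicator
      measurableSet_Ioc
  have hm := wageInv_mem hle ⟨hc0.le, hc1⟩
  have hm0 := wageInv_mem hle (c := 0) ⟨le_rfl, one_pos⟩
  have h1 : surplus f (clampExtend w₂) c ≤
      ∫ v, (Ioc c (wageInv w₂ c)).indicator (fun v => v - c) v ∂law f := by
    refine integral_mono_ae (integrable_surplus hf hmono c) (hint _ _) ?_
    filter_upwards [ae_law_mem f] with v hv
    have h2 : 0 ≤ (Ioc c (wageInv w₂ c)).indicator (fun v => v - c) v :=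
      indicator_apply_nonneg fun h => by linarith [h.1]
    refine indicator_apply_le' (fun h => ?_) fun _ => h2
    rcases le_or_gt v c with hvc | hvc
    · rwa [max_eq_right (by linarith)]
    · have h3 : w₂ v < c := (clampExtend_of_mem w₂ hv).symm.trans_lt h
      have h4 : v ≤ wageInv w₂ c := le_csSup ⟨1, fun _ h => h.1.2⟩ ⟨hv, h3.le⟩
      rw [indicator_of_mem (show v ∈ Ioc c (wageInv w₂ c) from ⟨hvc, h4⟩),
        max_eq_left (by linarith)]
  have h2 := hanti ⟨le_rfl, zero_le_one⟩ ⟨hc0.le, hc1.le⟩ hc0.le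
  simp only [hf.intervalIntegral_sub_mul hc0.le hm.1 hm.2,
    hf.intervalIntegral_sub_mul le_rfl hm0.1 hm0.2] at h2
  refine h1.trans (h2.trans (integral_mono_ae (hint _ _) (integrable_sub_wage hf hmono) ?_))
  -- Strictly below the supremum the wage vanishes by monotonicity; the endpoint is a null set.
  filter_upwards [ae_law_mem_Ico f, Measure.ae_ne _ (wageInv w₂ 0)] with v hv hne
  refine indicator_apply_le' (fun h => ?_) fun _ => sub_nonneg.2 (hle' v hv)
  obtain ⟨v', hv', hlt⟩ := exists_lt_of_lt_csSup (s := {v | v ∈ Icc (0 : ℝ) 1 ∧ w₂ v ≤ 0})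
    ⟨0, ⟨le_rfl, zero_le_one⟩, hle 0 ⟨le_rfl, one_pos⟩⟩ (lt_of_le_of_ne h.2 hne)
  have h3 := hw.mono (Ico_subset_Icc_self hv) hv'.1 hlt.le
  rw [clampExtend_of_mem _ (Ico_subset_Icc_self hv)]
  linarith [hv'.2]

theorem IsProductivityDensity.integral_id_pos {f : ℝ → ℝ} (hf : IsProductivityDensity f) :
    0 < ∫ v, v ∂law f := by
  have := hf.isProbabilityMeasure
  have hi : Integrable (fun v : ℝ => v) (law f) :=
    integrable_law_of_bound hf measurable_id 1 fun v hv => abs_le.2 ⟨by linarith [hv.1], hv.2⟩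
  have h : ∫ v, (Ioc (1 / 2 : ℝ) 1).indicator (fun _ => (1 / 2 : ℝ)) v ∂law f ≤ ∫ v, v ∂law f := by
    refine integral_mono_ae ((integrable_const _).indicator measurableSet_Ioc) hi ?_
    filter_upwards [ae_law_mem f] with v hv
    exact indicator_apply_le' (fun h => h.1.le) fun _ => hv.1
  refine lt_of_lt_of_le ?_ h
  rw [integral_indicator_const _ measurableSet_Ioc, smul_eq_mul]
  have : 0 < (law f).real (Ioc (1 / 2 : ℝ) 1) := ENNReal.toReal_pos
    (hf.law_Ioc_pos (by norm_num) (by norm_num) le_rfl).ne' (measure_ne_top _ _)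
  positivity

theorem exists_pos_threshold_zero (hf : ∀ g, IsProductivityDensity (f g)) :
    ∃ βs : ℝ, 0 < βs ∧ IsThreshold f (fun _ => 0) βs := by
  have hB := hf .B
  have := (hf .A).isProbabilityMeasure
  have h0 : clampExtend (fun _ => 0) = fun _ => 0 := rfl
  obtain ⟨βs, -, h, hb⟩ := exists_threshold hf (w₂ := fun _ => 0)
    ⟨fun _ _ => le_rfl, fun _ _ _ _ _ => le_rfl⟩ (fun v hv => hv.1) (fun c => by
      rw [h0]
      simp only [sub_zero]
      rcases le_or_gt c 0 with hc | hc
      · rw [surplus_of_nonpos (fun _ => le_rfl) hc]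
        exact hB.integral_id_pos.le
      · refine integral_mono_ae (integrable_surplus hB monotone_const c)
          (by simpa using integrable_sub_wage hB (monotone_const (c := (0 : ℝ)))) ?_
        filter_upwards [ae_law_mem (f .B)] with v hv
        exact indicator_apply_le' (fun _ => max_le (by linarith) hv.1) fun _ => hv.1)
  -- The lower bound is the mean productivity of group `B`: it equals the profit from group `A`,
  -- which is at most `β`.
  refine ⟨βs, hB.integral_id_pos.trans_le (hb _ fun β w hβ hw hwB => ?_), h⟩
  have h1 := hw.profit_eq
  rw [hwB, h0] at h1
  simp only [sub_zero] at h1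
  rw [← h1]
  refine mul_le_of_le_one_right hβ.le ?_
  have e : ∫ _, (1 : ℝ) ∂law (f .A) = 1 := by simp
  rw [← e]
  refine integral_mono_ae (integrable_sub_wage (hf .A) (hw.mono .A)) (integrable_const _) ?_
  filter_upwards [ae_law_mem (f .A)] with v hv
  exact (sub_le_self _ (hw.nonneg .A v)).trans hv.2

end EPSW

theorem mainTheorem8 (f : EPSW.WorkerGroup → ℝ → ℝ)
    (hf : ∀ g, EPSW.IsProductivityDensity (f g)) :
    (ContinuousOn (f .A) (Set.Icc 0 1) →
      ∀ w₂ : ℝ → ℝ, EPSW.IsWageFunction w₂ →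
        ContinuousOn w₂ (Set.Icc 0 1) →
        (∀ v ∈ Set.Ico (0 : ℝ) 1, w₂ v ≤ v) →
        AbsolutelyContinuousOnInterval (EPSW.wageInv w₂) 0 1 →
        AntitoneOn (fun ε : ℝ => ∫ v in ε..(EPSW.wageInv w₂ ε), (v - ε) * f .B v)
          (Set.Icc 0 1) →
        ∃ βs : ℝ, 0 ≤ βs ∧ EPSW.IsThreshold f w₂ βs) ∧
    (∃ βs : ℝ, 0 < βs ∧ EPSW.IsThreshold f (fun _ => 0) βs) := by
  refine ⟨fun _ w₂ hw _ hle _ hanti => ?_, EPSW.exists_pos_threshold_zero hf⟩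
  obtain ⟨βs, h0, h, -⟩ := EPSW.exists_threshold hf hw hle
    (EPSW.surplus_le_of_antitoneOn (hf .B) hw hle hanti)
  exact ⟨βs, h0, h⟩
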